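/- All local rings are commutative and Noetherian, and $\lambda$ denotes length. Let $R$ be a Gorenstein local ring and let $I\subseteq R$ be an ideal such that $R/I$ has finite length. For an ideal $L$ of a Gorenstein local ring $A$ with $A/L$ of finite length, let $\omega_{A/L}=\operatorname{Ext}^{h}_A(A/L,A)$, $h=\operatorname{height}L$, be the canonical module of $A/L$; let $(L/L^2)\otimes_{A/L}\omega_{A/L}$ be the twisted conormal module; and consider the inequality $$(\ast)\qquad \lambda_A\big((L/L^2)\otimes_{A/L}\omega_{A/L}\big)\ \ge\ (\dim A)\cdot\lambda_A(A/L).$$ We say that the pair $(R,I)$ deforms to a pair $(Q,J)$, where $Q$ is a local ring and $J\subseteq Q$ an ideal, if there are a sequence $\underline x$ in $Q$ that is regular on $Q$ and on $Q/J$, and a surjective ring homomorphism $\pi\colon Q\to R$ with kernel $(\underline x)$ and $\pi(J)=I$ (so that $Q/(\underline x)\cong R$ and $Q/(J+(\underline x))\cong R/I$). We say that $R$ deforms to $Q$ if $(R,0)$ deforms to $(Q,0)$; in that case $Q$ is again Gorenstein. The pair $(R,I)$ is smoothable if it deforms to some $(Q,J)$ such that for every associated prime $\mathfrak q$ of $Q/J$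 the ideal $J_{\mathfrak q}\subset Q_{\mathfrak q}$ is generated by a regular sequence. Proper ideals $I_1,I_2$ of $R$ are linked if there is a regular sequence $\underline x$ in $I_1\cap I_2$ with $I_2=((\underline x):_R I_1)$ and $I_1=((\underline x):_R I_2)$; the ideal $I$ is licci if there is a finite chain of ideals $I=I_0,I_1,\dots,I_n$ ($n\ge 0$), consecutive ones being linked, such that $I_n$ is generated by a regular sequence. Then $(\ast)$ holds for $(A,L)=(R,I)$ whenever one of the following conditions holds: 1. $R$ deforms to a local ring $Q$, with quotient map $\pi\colon Q\to R$, and $(\ast)$ holds for $(A,L)=(Q,\pi^{-1}(I))$; 2. $(R,I)$ is smoothable; 3. $I$ is licci. -/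

import Mathlib

universe u v

open CategoryTheory RingTheory.Sequence

/-- A Gorenstein local ring: a Noetherian local ring of finite injective dimension over itself. -/
class IsGorensteinLocalRing (R : Type u) [CommRing R] : Prop
    extends IsLocalRing R, IsNoetherianRing R where
  exists_hasInjectiveDimensionLE :
    ∃ n : ℕ, HasInjectiveDimensionLE (ModuleCat.of R R) n

/-- The module `Ext^d_R(R/I, R)` with `d = height I`. It is the canonical module `ω_{R/I}` of `R/I`
when `R` is a Gorenstein local ring and `R/I` is Cohen-Macaulay (in particular, when `R/I` has
finite length). -/
def QuotCanonicalModule {R : Type u} [CommRing R] (I : Ideal R) : Type u :=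
  Abelian.Ext (ModuleCat.of R (R ⧸ I)) (ModuleCat.of R R) I.height.toNat

namespace QuotCanonicalModule

variable {R : Type u} [CommRing R] (I : Ideal R)

noncomputable instance : AddCommGroup (QuotCanonicalModule I) :=
  inferInstanceAs (AddCommGroup
    (Abelian.Ext (ModuleCat.of R (R ⧸ I)) (ModuleCat.of R R) I.height.toNat))

noncomputable instance : Module R (QuotCanonicalModule I) :=
  inferInstanceAs (Module R
    (Abelian.Ext (ModuleCat.of R (R ⧸ I)) (ModuleCat.of R R) I.height.toNat))

theorem isTorsionBySet : Module.IsTorsionBySet R (QuotCanonicalModule I) I := by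
  intro x r
  have h : (r : R) • 𝟙 (ModuleCat.of R (R ⧸ I)) = 0 := by
    refine ModuleCat.hom_ext (LinearMap.ext fun z => ?_)
    obtain ⟨y, rfl⟩ := Ideal.Quotient.mk_surjective z
    change Ideal.Quotient.mk I ((r : R) * y) = 0
    exact Ideal.Quotient.eq_zero_iff_mem.mpr (I.mul_mem_right _ r.2)
  let x' : Abelian.Ext (ModuleCat.of R (R ⧸ I)) (ModuleCat.of R R) I.height.toNat := x
  change (r : R) • x' = 0
  rw [← Abelian.Ext.mk₀_id_comp x', ← Abelian.Ext.smul_comp, ← Abelian.Ext.mk₀_smul, h]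
  simp

noncomputable instance : Module (R ⧸ I) (QuotCanonicalModule I) :=
  (isTorsionBySet I).module

instance : IsScalarTower R (R ⧸ I) (QuotCanonicalModule I) :=
  (isTorsionBySet I).isScalarTower

end QuotCanonicalModule

/-- The twisted conormal module `(I/I²) ⊗_{R/I} ω_{R/I}`. -/
abbrev TwistedConormal {R : Type u} [CommRing R] (I : Ideal R) : Type u :=
  TensorProduct (R ⧸ I) I.Cotangent (QuotCanonicalModule I)

/-- The inequality `λ_R((I/I²) ⊗ ω_{R/I}) ≥ (dim R) · λ_R(R/I)`. -/
def ConormalInequality {R : Type u} [CommRing R] (I : Ideal R) : Prop :=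
  ringKrullDim R * (Module.length R (R ⧸ I) : WithBot ℕ∞) ≤
    (Module.length R (TwistedConormal I) : WithBot ℕ∞)

/-- The pair `(R, I)` deforms to the pair `(Q, J)`, with quotient map `π : Q ↠ R`: the kernel of the
surjection `π` is generated by a sequence that is regular on `Q` and on `Q/J`, and `I` is the image
of `J`. Thus `Q/(x) ≅ R` and, compatibly, `Q/(J + (x)) ≅ R/I`. -/
def DeformsAlong {R : Type u} {Q : Type v} [CommRing R] [CommRing Q] (π : Q →+* R)
    (I : Ideal R) (J : Ideal Q) : Prop :=
  Function.Surjective π ∧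
    ∃ xs : List Q, IsRegular Q xs ∧ IsRegular (Q ⧸ J) xs ∧
      RingHom.ker π = Ideal.ofList xs ∧ J.map π = I

/-- A complete intersection ideal: one that can be generated by a regular sequence. -/
def IsCompleteIntersectionIdeal {R : Type u} [CommRing R] (I : Ideal R) : Prop :=
  ∃ xs : List R, IsRegular R xs ∧ I = Ideal.ofList xs

/-- For each associated prime `q` of `Q/J`, the ideal `J_q` is generated by a regular sequence. -/
def IsGenericallyCompleteIntersection {Q : Type u} [CommRing Q] (J : Ideal Q) : Prop :=
  ∀ (q : Ideal Q) [q.IsPrime], q ∈ associatedPrimes Q (Q ⧸ J) →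
    IsCompleteIntersectionIdeal (J.map (algebraMap Q (Localization.AtPrime q)))

/-- `(R, I)` deforms to some `(Q, J)` with `Q` a Noetherian local ring and `J` generically a
complete intersection. -/
def IsSmoothable {R : Type u} [CommRing R] (I : Ideal R) : Prop :=
  ∃ (Q : Type v) (_ : CommRing Q) (_ : IsLocalRing Q) (_ : IsNoetherianRing Q)
    (π : Q →+* R) (J : Ideal Q), DeformsAlong π I J ∧ IsGenericallyCompleteIntersection J

/-- Proper ideals `I`, `J` are linked if, for some regular sequence `xs` contained in `I ∩ J`,
`J = ((xs) : I)` and `I = ((xs) : J)`. -/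
def IsLinked {R : Type u} [CommRing R] (I J : Ideal R) : Prop :=
  I ≠ ⊤ ∧ J ≠ ⊤ ∧ ∃ xs : List R, IsRegular R xs ∧ Ideal.ofList xs ≤ I ⊓ J ∧
    J = (Ideal.ofList xs).colon (I : Set R) ∧ I = (Ideal.ofList xs).colon (J : Set R)

/-- `I` is licci: a finite chain of links joins it to a complete intersection ideal. -/
def IsLicci {R : Type u} [CommRing R] (I : Ideal R) : Prop :=
  ∃ J : Ideal R, Relation.ReflTransGen IsLinked I J ∧ IsCompleteIntersectionIdeal J

/-!
Dualizing into the Artinian Gorenstein ring `R/(y)`, for `y` a maximal regular sequence in `I`,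
turns the inequality into `d · λ(R/I) ≤ λ(Hom(I, R/I))` with `d = dim R`.

* Deformation: let `R = Q/(x)` with `x` regular of length `n`, and let `L` be the preimage of `I`.
  Maps `L → R/I` that vanish on `(x)` are maps `I → R/I`, and restricting to `(x)` costs at most
  `λ(Hom((x), R/I)) = n · λ(R/I)`, which is also the difference of the two lower bounds.
* Linkage: if `I` and `J` are linked through `F = (x)`, then `λ(Hom(I, R/I)) - d · λ(R/I)` can be
  computed from the length of `(I ⊗ J)/(F ⊗ F)`, which is symmetric in `I` and `J`. So it is
  invariant under linkage, and it vanishes for a complete intersection.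
* Smoothability: for the deformation `(Q, J)`, a generic choice gives a map `J → (Q/J)^d` whose
  cokernel is killed by a nonzerodivisor on `Q/J`. Replacing `x₁, …, xₙ` by `x₁ᵏ, …, xₙᵏ` multiplies
  the lengths to be compared by `kⁿ`, while the cokernel contributes only `O(kⁿ⁻¹)`; let `k → ∞`.
-/

universe w

section Ext

open Abelian

variable {R : Type u} [CommRing R]

theorem smul_ext_eq_zero_of_mem_annihilator {M N : ModuleCat.{u} R} {r : R}
    (hr : r ∈ Module.annihilator R M) {i : ℕ} (x : Ext M N i) : r • x = 0 := by
  have h : r • 𝟙 M = 0 :=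
    ModuleCat.hom_ext (LinearMap.ext fun z => Module.mem_annihilator.mp hr z)
  rw [← Ext.mk₀_id_comp x, ← Ext.smul_comp, ← Ext.mk₀_smul, h, Ext.mk₀_zero, Ext.zero_comp]

theorem subsingleton_ext_of_subsingleton (M : Type u) [AddCommGroup M] [Module R M]
    [Subsingleton M] (N : ModuleCat.{u} R) (i : ℕ) :
    Subsingleton (Ext (ModuleCat.of R M) N i) :=
  have := (ModuleCat.isZero_of_subsingleton (ModuleCat.of R M)).hasProjectiveDimensionLT_zero
  HasProjectiveDimensionLT.subsingleton (ModuleCat.of R M) 0 i (Nat.zero_le i) N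

/-- Functoriality of `Extⁱ(-, N)` along a linear equivalence. -/
noncomputable def extCongrLeft {M M' : Type u} [AddCommGroup M] [Module R M] [AddCommGroup M']
    [Module R M'] (e : M ≃ₗ[R] M') (N : ModuleCat.{u} R) (i : ℕ) :
    Ext (ModuleCat.of R M) N i ≃ₗ[R] Ext (ModuleCat.of R M') N i :=
  LinearEquiv.ofLinearMap
    ((Ext.mk₀ (ModuleCat.ofHom e.symm.toLinearMap)).precompOfLinear R N (zero_add i))
    ((Ext.mk₀ (ModuleCat.ofHom e.toLinearMap)).precompOfLinear R N (zero_add i))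
    (LinearMap.ext fun x => by
      change (Ext.mk₀ _).comp ((Ext.mk₀ _).comp x (zero_add i)) (zero_add i) = x
      rw [Ext.mk₀_comp_mk₀_assoc, ← ModuleCat.ofHom_comp]
      simp)
    (LinearMap.ext fun x => by
      change (Ext.mk₀ _).comp ((Ext.mk₀ _).comp x (zero_add i)) (zero_add i) = x
      rw [Ext.mk₀_comp_mk₀_assoc, ← ModuleCat.ofHom_comp]
      simp)

section LongExactSequence

variable {M₁ M₂ M₃ : Type u} [AddCommGroup M₁] [AddCommGroup M₂] [AddCommGroup M₃]
  [Module R M₁] [Module R M₂] [Module R M₃] {f : M₁ →ₗ[R] M₂} {g : M₂ →ₗ[R] M₃}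
  (hf : Function.Injective f) (hfg : Function.Exact f g) (hg : Function.Surjective g)
  (N : ModuleCat.{u} R) (i : ℕ)

include hf hfg hg

theorem shortExact_shortComplexOfCompEqZero :
    (ModuleCat.shortComplexOfCompEqZero f g hfg.linearMap_comp_eq_zero).ShortExact :=
  ModuleCat.shortComplex_shortExact _ hfg hf hg

theorem ext_precomp_surjective (h₃ : Subsingleton (Ext (ModuleCat.of R M₃) N (i + 1))) :
    Function.Surjective ((Ext.mk₀ (ModuleCat.ofHom f)).precompOfLinear R N (zero_add i)) :=
  fun x => Ext.contravariant_sequence_exact₁ (shortExact_shortComplexOfCompEqZero hf hfg hg) N x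
    (add_comm 1 i) (h₃.elim _ _)

theorem ext_precomp_injective
    (h₁ : ∀ j, j + 1 = i → Subsingleton (Ext (ModuleCat.of R M₁) N j)) :
    Function.Injective ((Ext.mk₀ (ModuleCat.ofHom g)).precompOfLinear R N (zero_add i)) := by
  cases i with
  | zero =>
    have : Epi (ModuleCat.ofHom g) := (ModuleCat.epi_iff_surjective _).mpr hg
    exact Ext.precomp_mk₀_injective_of_epi N (ModuleCat.ofHom g)
  | succ i =>
    rw [injective_iff_map_eq_zero]
    intro x hx
    obtain ⟨z, hz⟩ := Ext.contravariant_sequence_exact₃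
      (shortExact_shortComplexOfCompEqZero hf hfg hg) N x hx (add_comm 1 i)
    rw [← hz, (h₁ i rfl).elim z 0, Ext.comp_zero]

theorem subsingleton_ext_middle (h₁ : Subsingleton (Ext (ModuleCat.of R M₁) N i))
    (h₃ : Subsingleton (Ext (ModuleCat.of R M₃) N i)) :
    Subsingleton (Ext (ModuleCat.of R M₂) N i) := by
  refine subsingleton_of_forall_eq 0 fun x => ?_
  obtain ⟨z, hz⟩ := Ext.contravariant_sequence_exact₂
    (shortExact_shortComplexOfCompEqZero hf hfg hg) N x (h₁.elim _ _)
  rw [← hz, h₃.elim z 0, Ext.comp_zero]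

theorem subsingleton_ext_left (h₂ : Subsingleton (Ext (ModuleCat.of R M₂) N i))
    (h₃ : Subsingleton (Ext (ModuleCat.of R M₃) N (i + 1))) :
    Subsingleton (Ext (ModuleCat.of R M₁) N i) :=
  have := h₂
  (ext_precomp_surjective hf hfg hg N i h₃).subsingleton

theorem length_ext_eq_add
    (h₁ : ∀ j, j + 1 = i → Subsingleton (Ext (ModuleCat.of R M₁) N j))
    (h₃ : Subsingleton (Ext (ModuleCat.of R M₃) N (i + 1))) :
    Module.length R (Ext (ModuleCat.of R M₂) N i) =
      Module.length R (Ext (ModuleCat.of R M₃) N i) +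
        Module.length R (Ext (ModuleCat.of R M₁) N i) := by
  refine Module.length_eq_add_of_exact _ _ (ext_precomp_injective hf hfg hg N i h₁)
    (ext_precomp_surjective hf hfg hg N i h₃) ?_
  have h := Ext.contravariant_sequence_exact₂'
    (shortExact_shortComplexOfCompEqZero hf hfg hg) N i
  rwa [ShortComplex.ab_exact_iff_function_exact] at h

end LongExactSequence

section RegularSequence

variable [IsNoetherianRing R]

theorem subsingleton_ext_of_lt_length {M N : ModuleCat.{u} R} [Module.Finite R M]
    [Module.Finite R N] {ys : List R} (reg : IsRegular N ys)
    (hM : Ideal.ofList ys ≤ Module.annihilator R M) {i : ℕ} (hi : i < ys.length) :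
    Subsingleton (Ext M N i) :=
  ModuleCat.subsingleton_ext_of_exists_isRegular (Ideal.ofList ys) M
    (by rw [Module.support_eq_zeroLocus]; exact PrimeSpectrum.zeroLocus_anti_mono hM)
    N (lt_top_iff_ne_top.mpr reg.2.symm) ys (fun _ hr => Ideal.subset_span hr) reg i hi

/-- Each element of the sequence kills `M`, so the connecting maps of the sequences
`0 → N → N → N/y → 0` are isomorphisms, which lowers the degree by one at each step. -/
theorem nonempty_ext_length_equiv_linearMap (M : ModuleCat.{u} R) [Module.Finite R M]
    (ys : List R) (N : ModuleCat.{u} R) [Module.Finite R N] (reg : IsRegular N ys)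
    (hM : Ideal.ofList ys ≤ Module.annihilator R M) :
    Nonempty (Ext M N ys.length ≃ₗ[R]
      (M →ₗ[R] (N ⧸ (Ideal.ofList ys • ⊤ : Submodule R N)))) := by
  induction ys generalizing N with
  | nil =>
    exact ⟨(Ext.linearEquiv₀ (R := R)).trans (ModuleCat.homLinearEquiv.trans
      (LinearEquiv.congrRight (Submodule.quotEquivOfEqBot _ (by simp)).symm))⟩
  | cons y ys ih =>
    have hsub : Subsingleton (Ext M N ys.length) :=
      subsingleton_ext_of_lt_length reg hM (by simp)
    have hy : y ∈ Module.annihilator R M := hM (Ideal.subset_span (by simp))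
    have reg' := (isRegular_cons_iff N y ys).mp reg
    have hS := reg'.1.smulShortComplex_shortExact (M := N)
    obtain ⟨e⟩ := ih (ModuleCat.of R (QuotSMulTop y N)) reg'.2
      (le_sup_right.trans (Ideal.ofList_cons y ys ▸ hM))
    let δ : Ext M (ModuleCat.of R (QuotSMulTop y N)) ys.length →ₗ[R]
        Ext M N (ys.length + 1) := hS.extClass.postcompOfLinear R M rfl
    have hδ : Function.Bijective δ := by
      constructor
      · rw [injective_iff_map_eq_zero]
        intro x hx
        obtain ⟨x₂, hx₂⟩ := Ext.covariant_sequence_exact₃ M hS x rfl hx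
        exact hx₂.symm.trans (hsub.elim x₂ 0 ▸ Ext.zero_comp ..)
      · intro x
        refine Ext.covariant_sequence_exact₁ M hS x ?_ rfl
        have := smul_ext_eq_zero_of_mem_annihilator hy x
        rwa [Ext.smul_eq_comp_mk₀] at this
    exact ⟨(LinearEquiv.ofBijective δ hδ).symm.trans (e.trans (LinearEquiv.congrRight
      (Submodule.quotOfListConsSMulTopEquivQuotSMulTopInner N y ys).symm))⟩

theorem nonempty_ext_length_equiv_linearMap_quotient (M : Type u) [AddCommGroup M] [Module R M]
    [Module.Finite R M] {ys : List R} (reg : IsRegular R ys)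
    (hM : Ideal.ofList ys ≤ Module.annihilator R M) :
    Nonempty (Ext (ModuleCat.of R M) (ModuleCat.of R R) ys.length ≃ₗ[R]
      (M →ₗ[R] (R ⧸ Ideal.ofList ys))) := by
  obtain ⟨e⟩ :=
    nonempty_ext_length_equiv_linearMap (ModuleCat.of R M) ys (ModuleCat.of R R) reg hM
  exact ⟨e.trans (LinearEquiv.congrRight
    (Submodule.quotEquivOfEq _ _ (Ideal.ofList ys).mul_top))⟩

end RegularSequence

end Ext

section Length

variable {R : Type u} [CommRing R] {M N P : Type*} [AddCommGroup M] [AddCommGroup N]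
  [AddCommGroup P] [Module R M] [Module R N] [Module R P]

theorem length_eq_length_add_length_quotient (S : Submodule R M) :
    Module.length R M = Module.length R S + Module.length R (M ⧸ S) :=
  Module.length_eq_add_of_exact S.subtype S.mkQ S.injective_subtype S.mkQ_surjective
    (LinearMap.exact_subtype_mkQ S)

theorem length_ker_add_length_range (f : M →ₗ[R] P) :
    Module.length R (LinearMap.ker f) + Module.length R (LinearMap.range f) =
      Module.length R M := by
  rw [length_eq_length_add_length_quotient (LinearMap.ker f), f.quotKerEquivRange.length_eq]

theorem length_le_length_ker_add (f : M →ₗ[R] P) :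
    Module.length R M ≤ Module.length R (LinearMap.ker f) + Module.length R P := by
  rw [← length_ker_add_length_range f]
  exact add_le_add_right (Module.length_le_of_injective _ (Submodule.injective_subtype _)) _

theorem length_le_add_of_exact {f : N →ₗ[R] M} {g : M →ₗ[R] P} (h : Function.Exact f g) :
    Module.length R M ≤ Module.length R N + Module.length R P := by
  refine (length_le_length_ker_add g).trans (add_le_add_left ?_ _)
  rw [h.linearMap_ker_eq]
  exact Module.length_le_of_surjective _ f.surjective_rangeRestrict

theorem surjective_of_injective_of_length_le {f : M →ₗ[R] N} (hf : Function.Injective f)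
    (hle : Module.length R N ≤ Module.length R M) (hN : Module.length R N ≠ ⊤) :
    Function.Surjective f := by
  have hM : Module.length R M ≠ ⊤ := ne_top_of_le_ne_top hN (Module.length_le_of_injective f hf)
  have hcoker : Module.length R (N ⧸ LinearMap.range f) = 0 := by
    rw [length_eq_length_add_length_quotient (LinearMap.range f),
      ← (LinearEquiv.ofInjective f hf).length_eq] at hle
    refine le_antisymm ((ENat.add_le_add_iff_left hM).mp ?_) bot_le
    rwa [add_zero]
  rwa [Module.length_eq_zero_iff, Submodule.Quotient.subsingleton_iff,
    LinearMap.range_eq_top] at hcoker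

end Length

section CyclicModule

variable {R : Type u} [CommRing R] (I : Ideal R) (N : Type v) [AddCommGroup N] [Module R N]

/-- Evaluation at `1` identifies the linear maps out of the cyclic module `R ⧸ I` with the
elements killed by `I`. -/
def linearMapQuotientEquivTorsionBySet :
    ((R ⧸ I) →ₗ[R] N) ≃ₗ[R] Submodule.torsionBySet R N I where
  toFun f := ⟨f (Ideal.Quotient.mk I 1), (Submodule.mem_torsionBySet_iff _ _).mpr fun r => by
    rw [← map_smul, show r.1 • Ideal.Quotient.mk I 1 = 0 from
      Ideal.Quotient.eq_zero_iff_mem.mpr (I.mul_mem_right 1 r.2), map_zero]⟩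
  map_add' _ _ := rfl
  map_smul' _ _ := rfl
  invFun n := I.liftQ (LinearMap.toSpanSingleton R N n)
    fun r hr => (Submodule.mem_torsionBySet_iff _ _).mp n.2 ⟨r, hr⟩
  left_inv f := Submodule.linearMap_qext _ (LinearMap.ext_ring (one_smul R _))
  right_inv n := Subtype.ext (one_smul R n.1)

variable {I N}

/-- `linearMapQuotientEquivTorsionBySet` for a module killed by `I`. -/
def linearMapQuotientEquiv (h : I ≤ Module.annihilator R N) : ((R ⧸ I) →ₗ[R] N) ≃ₗ[R] N :=
  (linearMapQuotientEquivTorsionBySet I N).trans (LinearEquiv.ofTop _ (eq_top_iff.mpr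
    fun n _ => (Submodule.mem_torsionBySet_iff _ _).mpr
      fun r => Module.mem_annihilator.mp (h r.2) n))

/-- `linearMapQuotientEquiv` for a finite power of the cyclic module `R ⧸ I`. -/
def linearMapPiQuotientEquiv (d : ℕ) (h : I ≤ Module.annihilator R N) :
    ((Fin d → R ⧸ I) →ₗ[R] N) ≃ₗ[R] (Fin d → N) :=
  (LinearMap.lsum R (fun _ => R ⧸ I) R).symm.trans
    (LinearEquiv.piCongrRight fun _ => linearMapQuotientEquiv h)

theorem length_linearMap_pi_quotient (d : ℕ) (h : I ≤ Module.annihilator R N) :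
    Module.length R ((Fin d → R ⧸ I) →ₗ[R] N) = d * Module.length R N := by
  rw [(linearMapPiQuotientEquiv d h).length_eq, Module.length_pi_of_fintype, Finset.sum_const,
    Finset.card_univ, Fintype.card_fin, nsmul_eq_mul]

end CyclicModule

section Dimension

open IsLocalRing

variable {R : Type u} [CommRing R]

theorem ofList_ne_top_of_isRegular {ys : List R} (reg : IsRegular R ys) : Ideal.ofList ys ≠ ⊤ :=
  fun h => reg.2 (by rw [h, Submodule.top_smul])

theorem nontrivial_quotient_ofList {ys : List R} (reg : IsRegular R ys) :
    Nontrivial (R ⧸ Ideal.ofList ys) :=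
  Ideal.Quotient.nontrivial_iff.mpr (ofList_ne_top_of_isRegular reg)

theorem isFiniteLength_quotient_iff_krullDimLE_zero [IsNoetherianRing R] {I : Ideal R} :
    IsFiniteLength R (R ⧸ I) ↔ Ring.KrullDimLE 0 (R ⧸ I) := by
  rw [isFiniteLength_iff_isNoetherian_isArtinian, ← isArtinianRing_iff_krullDimLE_zero]
  exact ⟨fun h => isArtinian_of_tower R h.2, fun h =>
    ⟨inferInstance, isArtinian_of_surjective_algebraMap (R := R ⧸ I) Ideal.Quotient.mk_surjective⟩⟩

variable [IsLocalRing R]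

theorem nonempty_equiv_residue_of_isSimpleModule (M : Type v) [AddCommGroup M] [Module R M]
    [IsSimpleModule R M] : Nonempty (M ≃ₗ[R] (R ⧸ maximalIdeal R)) := by
  obtain ⟨n, hn, ⟨e⟩⟩ := isSimpleModule_iff_quot_maximal.mp ‹IsSimpleModule R M›
  exact ⟨eq_maximalIdeal hn ▸ e⟩

variable [IsNoetherianRing R]

theorem length_le_ringKrullDim_of_isRegular {ys : List R} (reg : IsRegular R ys) :
    (ys.length : WithBot ℕ∞) ≤ ringKrullDim R := by
  have := nontrivial_quotient_ofList reg
  rw [← ringKrullDim_add_length_eq_ringKrullDim_of_isRegular ys reg]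
  exact le_add_of_nonneg_left ringKrullDim_nonneg_of_nontrivial

theorem isFiniteLength_quotient_ofList_iff {ys : List R} (reg : IsRegular R ys) :
    IsFiniteLength R (R ⧸ Ideal.ofList ys) ↔ ringKrullDim R = ys.length := by
  have := nontrivial_quotient_ofList reg
  rw [isFiniteLength_quotient_iff_krullDimLE_zero, ringKrullDimZero_iff_ringKrullDim_eq_zero,
    ← ringKrullDim_add_length_eq_ringKrullDim_of_isRegular ys reg,
    ← ENat.WithBot.add_natCast_cancel (c := ys.length), zero_add]

variable (R) in
theorem exists_isRegular_forall_length_le :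
    ∃ ys : List R, IsRegular R ys ∧ ∀ zs : List R, IsRegular R zs → zs.length ≤ ys.length := by
  have hbdd : BddAbove {n | ∃ ys : List R, IsRegular R ys ∧ ys.length = n} := by
    refine ⟨(LTSeries.longestOf (PrimeSpectrum R)).length, ?_⟩
    rintro _ ⟨ys, reg, rfl⟩
    have hle := length_le_ringKrullDim_of_isRegular reg
    rw [ringKrullDim, Order.krullDim_eq_length_of_finiteDimensionalOrder] at hle
    exact_mod_cast hle
  obtain ⟨_, ⟨ys, reg, rfl⟩, hmax⟩ :=
    hbdd.exists_isGreatest_of_nonempty ⟨_, [], IsRegular.nil R R, rfl⟩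
  exact ⟨ys, reg, fun zs regz => hmax ⟨zs, regz, rfl⟩⟩

end Dimension

section Gorenstein

open Abelian IsLocalRing

/-- The functor `Extⁱ(-, N)` vanishes on all finitely generated modules. -/
def ExtVanishesOnFinite {R : Type u} [CommRing R] (N : ModuleCat.{u} R) (i : ℕ) : Prop :=
  ∀ (M : Type u) [AddCommGroup M] [Module R M] [Module.Finite R M],
    Subsingleton (Ext (ModuleCat.of R M) N i)

variable {R : Type u} [CommRing R] [IsLocalRing R] [IsNoetherianRing R]

/-- For `a ∈ 𝔪 \ p` the vanishing in degree `i + 1` makes multiplication by `a` surjective on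
`Extⁱ(R/p, N)`, and Nakayama's lemma applies. -/
theorem ExtVanishesOnFinite.subsingleton_ext_quotient_prime {N : ModuleCat.{u} R}
    [Module.Finite R N] {i : ℕ} (hi : ExtVanishesOnFinite N (i + 1)) {p : Ideal R}
    [hp : p.IsPrime] (hpm : p ≠ maximalIdeal R) :
    Subsingleton (Ext (ModuleCat.of R (R ⧸ p)) N i) := by
  obtain ⟨a, ham, hap⟩ := Set.not_subset.mp
    fun h : (maximalIdeal R : Set R) ⊆ p => hpm ((le_maximalIdeal hp.ne_top').antisymm h)
  let f : (R ⧸ p) →ₗ[R] (R ⧸ p) := LinearMap.lsmul R (R ⧸ p) a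
  have hf : Function.Injective f := by
    rw [injective_iff_map_eq_zero]
    intro x hx
    obtain ⟨x, rfl⟩ := Ideal.Quotient.mk_surjective x
    have hx' : Ideal.Quotient.mk p (a * x) = 0 := hx
    rw [Ideal.Quotient.eq_zero_iff_mem] at hx' ⊢
    exact (hp.mem_or_mem hx').resolve_left hap
  have hsurj := ext_precomp_surjective hf (LinearMap.exact_map_mkQ_range f)
    (Submodule.mkQ_surjective _) N i (hi _)
  have hsmul : (Ext.mk₀ (ModuleCat.ofHom f)).precompOfLinear R N (zero_add i) =
      LinearMap.lsmul R _ a := by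
    ext y
    change (Ext.mk₀ (a • 𝟙 (ModuleCat.of R (R ⧸ p)))).comp y (zero_add i) = a • y
    rw [Ext.mk₀_smul, Ext.smul_comp, Ext.mk₀_id_comp]
  have hbot : (⊤ : Submodule R (Ext (ModuleCat.of R (R ⧸ p)) N i)) = ⊥ := by
    refine Submodule.eq_bot_of_le_smul_of_le_jacobson_bot (Ideal.span {a}) ⊤
      (Module.finite_def.mp (ModuleCat.finite_ext R _ _ i)) (fun x _ => ?_)
      ((Ideal.span_singleton_le_iff_mem _).mpr (maximalIdeal_le_jacobson _ ham))
    obtain ⟨y, rfl⟩ := hsurj x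
    rw [hsmul]
    exact Submodule.smul_mem_smul (Ideal.mem_span_singleton_self a) trivial
  exact (Submodule.subsingleton_iff R).mp (subsingleton_of_bot_eq_top hbot.symm)

theorem ExtVanishesOnFinite.of_residue {N : ModuleCat.{u} R} [Module.Finite R N] {i : ℕ}
    (hi : ExtVanishesOnFinite N (i + 1))
    (hk : Subsingleton (Ext (ModuleCat.of R (R ⧸ maximalIdeal R)) N i)) :
    ExtVanishesOnFinite N i := by
  intro M _ _ _
  refine IsNoetherianRing.induction_on_isQuotientEquivQuotientPrime R ‹_›
    (motive := fun M _ _ _ => Subsingleton (Ext (ModuleCat.of R M) N i)) ?_ ?_ ?_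
  · intro M _ _ _ _
    exact subsingleton_ext_of_subsingleton M N i
  · intro M _ _ _ p e
    refine (extCongrLeft e N i).subsingleton_congr.mpr ?_
    by_cases hp : p.asIdeal = maximalIdeal R
    · rwa [hp]
    · exact hi.subsingleton_ext_quotient_prime hp
  · intro M₁ _ _ _ M₂ _ _ _ M₃ _ _ _ f g hf hg hfg h₁ h₃
    exact subsingleton_ext_middle hf hfg hg N i h₁ h₃

variable (R) in
/-- The socle modulo a regular sequence `ys` of maximal length is nonzero: it is the first
`Extⁱ(R/𝔪, R)` that the vanishing up to degree `ys.length` does not cover. -/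
theorem exists_isRegular_nontrivial_linearMap_residue :
    ∃ ys : List R, IsRegular R ys ∧
      Nontrivial ((R ⧸ maximalIdeal R) →ₗ[R] (R ⧸ Ideal.ofList ys)) := by
  obtain ⟨ys, reg, hmax⟩ := exists_isRegular_forall_length_le R
  refine ⟨ys, reg, ?_⟩
  by_contra hnt
  rw [not_nontrivial_iff_subsingleton] at hnt
  have hann : Ideal.ofList ys ≤ Module.annihilator R (R ⧸ maximalIdeal R) := by
    rw [Ideal.annihilator_quotient]
    exact le_maximalIdeal (ofList_ne_top_of_isRegular reg)
  obtain ⟨e⟩ := nonempty_ext_length_equiv_linearMap_quotient (R ⧸ maximalIdeal R) reg hann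
  have hext : ∀ i < ys.length + 1, Subsingleton
      (Ext (ModuleCat.of R (R ⧸ maximalIdeal R)) (ModuleCat.of R R) i) := by
    intro i hi
    rcases Nat.lt_succ_iff_lt_or_eq.mp hi with hi | rfl
    · exact subsingleton_ext_of_lt_length reg hann hi
    · exact e.subsingleton
  obtain ⟨zs, hzs, -, regz⟩ := ModuleCat.exists_isRegular_of_exists_subsingleton_ext
    (maximalIdeal R) (ys.length + 1) (ModuleCat.of R R)
    (by simpa [lt_top_iff_ne_top] using (maximalIdeal.isMaximal R).ne_top)
    (ModuleCat.of R (R ⧸ maximalIdeal R))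
    (by rw [Module.support_eq_zeroLocus, Ideal.annihilator_quotient]) hext
  have := hmax zs regz
  omega

theorem subsingleton_ext_quotient_ofList {ys : List R} (reg : IsRegular R ys)
    (N : ModuleCat.{u} R) {i : ℕ} (hi : ys.length < i) :
    Subsingleton (Ext (ModuleCat.of R (R ⧸ Ideal.ofList ys)) N i) := by
  have : HasProjectiveDimensionLE
      (ModuleCat.of R (Shrink.{u} (R ⧸ Ideal.ofList ys))) ys.length := by
    rw [← projectiveDimension_le_iff, ModuleCat.projectiveDimension_quotient_eq_length.{u} ys reg]
  exact (extCongrLeft (Shrink.linearEquiv R (R ⧸ Ideal.ofList ys)) N i).subsingleton_congr.mp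
    (HasProjectiveDimensionLT.subsingleton _ (ys.length + 1) i hi N)

/-- Descending induction on `i`, starting from the injective dimension: an embedding
`R/𝔪 → R/(ys)` shows that `Extⁱ(R/𝔪, R)` is a quotient of `Extⁱ(R/(ys), R) = 0`. -/
theorem extVanishesOnFinite_self_of_length_lt {n : ℕ}
    (hn : HasInjectiveDimensionLE (ModuleCat.of R R) n) {ys : List R} (reg : IsRegular R ys)
    (hk : Nontrivial ((R ⧸ maximalIdeal R) →ₗ[R] (R ⧸ Ideal.ofList ys))) {i : ℕ}
    (hi : ys.length < i) : ExtVanishesOnFinite (ModuleCat.of R R) i := by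
  have hlarge : ∀ j, n + 1 ≤ j → ExtVanishesOnFinite (ModuleCat.of R R) j :=
    fun j hj M _ _ _ => HasInjectiveDimensionLT.subsingleton (ModuleCat.of R R) (n + 1) j hj _
  rcases le_total (n + 1) i with hin | hin
  · exact hlarge i hin
  induction hin using Nat.decreasingInduction with
  | self => exact hlarge _ le_rfl
  | of_succ i _ ih =>
    have hnext := ih (by omega)
    refine hnext.of_residue ?_
    obtain ⟨f, hf⟩ := exists_ne (0 : (R ⧸ maximalIdeal R) →ₗ[R] (R ⧸ Ideal.ofList ys))
    have : IsSimpleModule R (R ⧸ maximalIdeal R) :=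
      isSimpleModule_iff_quot_maximal.mpr ⟨_, maximalIdeal.isMaximal R, ⟨LinearEquiv.refl _ _⟩⟩
    exact subsingleton_ext_left (LinearMap.injective_of_ne_zero hf)
      (LinearMap.exact_map_mkQ_range f) (Submodule.mkQ_surjective _) _ i
      (subsingleton_ext_quotient_ofList reg _ hi) (hnext _)

/-- A minimal prime `q ≠ 𝔪` over `(ys)` would be associated to `R/(ys)`, although
`Hom(R/q, R/(ys))` is `Ext` of `R/q` in degree `ys.length`, which vanishes. -/
theorem ExtVanishesOnFinite.isFiniteLength_quotient_ofList {ys : List R} (reg : IsRegular R ys)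
    (hvan : ExtVanishesOnFinite (ModuleCat.of R R) (ys.length + 1)) :
    IsFiniteLength R (R ⧸ Ideal.ofList ys) := by
  rw [isFiniteLength_quotient_iff_krullDimLE_zero,
    Ideal.krullDimLE_zero_quotient_iff_forall_minimalPrimes_isMaximal]
  intro q hq
  by_cases hqm : q = maximalIdeal R
  · exact hqm ▸ maximalIdeal.isMaximal R
  have hqprime : q.IsPrime := hq.1.1
  have hass : q ∈ associatedPrimes R (R ⧸ Ideal.ofList ys) := by
    refine Module.associatedPrimes.minimalPrimes_annihilator_subset_associatedPrimes R _ ?_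
    rwa [Ideal.annihilator_quotient]
  obtain ⟨-, f, hf⟩ := (isAssociatedPrime_iff_exists_injective_linearMap _ _).mp hass
  obtain ⟨e⟩ := nonempty_ext_length_equiv_linearMap_quotient (R ⧸ q) reg
    (by rw [Ideal.annihilator_quotient]; exact hq.1.2)
  have := hvan.subsingleton_ext_quotient_prime hqm
  have hf₀ : f = 0 := e.symm.subsingleton.elim f 0
  have : Nontrivial (R ⧸ q) := Ideal.Quotient.nontrivial_iff.mpr hqprime.ne_top
  exact absurd (hf₀ ▸ hf) Function.not_injective_const

theorem subsingleton_ext_of_isFiniteLength {ys : List R} (reg : IsRegular R ys) {i : ℕ}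
    (hi : i < ys.length) {M : Type u} [AddCommGroup M] [Module R M] (hM : IsFiniteLength R M) :
    Subsingleton (Ext (ModuleCat.of R M) (ModuleCat.of R R) i) := by
  induction hM with
  | @of_subsingleton M => exact subsingleton_ext_of_subsingleton M _ i
  | @of_simple_quotient M _ _ N _ _ ih =>
    obtain ⟨e⟩ := nonempty_equiv_residue_of_isSimpleModule (R := R) (M ⧸ N)
    have hk : Subsingleton (Ext (ModuleCat.of R (R ⧸ maximalIdeal R)) (ModuleCat.of R R) i) :=
      subsingleton_ext_of_lt_length reg (by
        rw [Ideal.annihilator_quotient]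
        exact le_maximalIdeal (ofList_ne_top_of_isRegular reg)) hi
    exact subsingleton_ext_middle N.injective_subtype (LinearMap.exact_subtype_mkQ N)
      N.mkQ_surjective _ i ih ((extCongrLeft e _ i).subsingleton_congr.mpr hk)

theorem ExtVanishesOnFinite.length_ext_of_isFiniteLength {ys : List R} (reg : IsRegular R ys)
    (hvan : ExtVanishesOnFinite (ModuleCat.of R R) (ys.length + 1))
    {M : Type u} [AddCommGroup M] [Module R M] (hM : IsFiniteLength R M) :
    Module.length R (Ext (ModuleCat.of R M) (ModuleCat.of R R) ys.length) =
      Module.length R M * Module.length R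
        (Ext (ModuleCat.of R (R ⧸ maximalIdeal R)) (ModuleCat.of R R) ys.length) := by
  induction hM with
  | @of_subsingleton M =>
    have := subsingleton_ext_of_subsingleton M (ModuleCat.of R R) ys.length
    rw [Module.length_eq_zero, Module.length_eq_zero, zero_mul]
  | @of_simple_quotient M _ _ N _ hN ih =>
    obtain ⟨e⟩ := nonempty_equiv_residue_of_isSimpleModule (R := R) (M ⧸ N)
    have : Module.Finite R (M ⧸ N) := Module.Finite.equiv e.symm
    rw [length_ext_eq_add N.injective_subtype (LinearMap.exact_subtype_mkQ N)
      N.mkQ_surjective _ ys.length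
      (fun j hj => subsingleton_ext_of_isFiniteLength reg (by omega) hN) (hvan _), ih,
      (extCongrLeft e _ _).length_eq, length_eq_length_add_length_quotient N,
      Module.length_eq_one R (M ⧸ N), add_mul, one_mul, add_comm]

end Gorenstein

section ArtinGorenstein

open Abelian IsLocalRing

/-- The ideal `𝔞` defines an Artinian Gorenstein quotient: `R ⧸ 𝔞` has finite length and its
socle, realised as `Hom(R/𝔪, R/𝔞)`, is simple. -/
structure IsArtinGorensteinIdeal {R : Type u} [CommRing R] [IsLocalRing R] (𝔞 : Ideal R) :
    Prop where
  isFiniteLength : IsFiniteLength R (R ⧸ 𝔞)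
  isSimpleModule_socle : IsSimpleModule R ((R ⧸ maximalIdeal R) →ₗ[R] (R ⧸ 𝔞))

namespace IsGorensteinLocalRing

variable (R : Type u) [CommRing R] [IsGorensteinLocalRing R]

theorem exists_isRegular_extVanishesOnFinite : ∃ ys : List R, IsRegular R ys ∧
    ringKrullDim R = ys.length ∧
      ExtVanishesOnFinite (ModuleCat.of R R) (ys.length + 1) := by
  obtain ⟨n, hn⟩ := exists_hasInjectiveDimensionLE (R := R)
  obtain ⟨ys, reg, hk⟩ := exists_isRegular_nontrivial_linearMap_residue R
  have hvan : ExtVanishesOnFinite (ModuleCat.of R R) (ys.length + 1) :=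
    extVanishesOnFinite_self_of_length_lt hn reg hk (Nat.lt_succ_self _)
  exact ⟨ys, reg, (isFiniteLength_quotient_ofList_iff reg).mp
    (hvan.isFiniteLength_quotient_ofList reg), hvan⟩

variable {R}

theorem exists_isRegular_of_isFiniteLength {I : Ideal R} (hI : I ≠ ⊤)
    (hfin : IsFiniteLength R (R ⧸ I)) :
    ∃ ys : List R, IsRegular R ys ∧ ringKrullDim R = ys.length ∧ Ideal.ofList ys ≤ I := by
  obtain ⟨ys, reg, hys, -⟩ := exists_isRegular_extVanishesOnFinite R
  obtain ⟨zs, hlen, hmem, regz⟩ := ModuleCat.exists_isRegular_of_exists_subsingleton_ext I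
    ys.length (ModuleCat.of R R) (by simpa [lt_top_iff_ne_top] using hI) (ModuleCat.of R (R ⧸ I))
    (by rw [Module.support_eq_zeroLocus, Ideal.annihilator_quotient])
    (fun i hi => subsingleton_ext_of_isFiniteLength reg hi hfin)
  exact ⟨zs, regz, by rw [hlen, hys], Ideal.span_le.mpr hmem⟩

/-- For `M = R/(zs)` the formula `λ Extᵈ(M, R) = λ(M) · λ Extᵈ(R/𝔪, R)` reads
`λ(R/(zs)) = λ(R/(zs)) · λ Hom(R/𝔪, R/(zs))`. -/
theorem isArtinGorensteinIdeal_ofList {zs : List R} (reg : IsRegular R zs)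
    (hlen : ringKrullDim R = zs.length) : IsArtinGorensteinIdeal (Ideal.ofList zs) := by
  have hfin := (isFiniteLength_quotient_ofList_iff reg).mpr hlen
  refine ⟨hfin, Module.length_eq_one_iff.mp ?_⟩
  obtain ⟨ys, -, hys, hvan⟩ := exists_isRegular_extVanishesOnFinite R
  have hyz : ys.length = zs.length := by exact_mod_cast hys.symm.trans hlen
  rw [hyz] at hvan
  have hann : Ideal.ofList zs ≤ Module.annihilator R (R ⧸ Ideal.ofList zs) :=
    Ideal.annihilator_quotient.ge
  obtain ⟨e⟩ := nonempty_ext_length_equiv_linearMap_quotient (R ⧸ Ideal.ofList zs) reg hann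
  obtain ⟨e'⟩ := nonempty_ext_length_equiv_linearMap_quotient (R ⧸ maximalIdeal R) reg
    (by rw [Ideal.annihilator_quotient]; exact le_maximalIdeal (ofList_ne_top_of_isRegular reg))
  have hmul := hvan.length_ext_of_isFiniteLength reg hfin
  rw [e.length_eq, e'.length_eq, (linearMapQuotientEquiv hann).length_eq] at hmul
  have := nontrivial_quotient_ofList reg
  exact (ENat.mul_right_strictMono Module.length_pos.ne'
    (Module.length_ne_top_iff.mpr hfin)).injective (hmul.symm.trans (mul_one _).symm)

end IsGorensteinLocalRing

end ArtinGorenstein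

section Annihilator

variable {R : Type u} [CommRing R] {𝔞 : Ideal R} {M : Type v} {N : Type w} [AddCommGroup M]
  [Module R M] [AddCommGroup N] [Module R N]

theorem le_annihilator_linearMap_of_left (h : 𝔞 ≤ Module.annihilator R M) :
    𝔞 ≤ Module.annihilator R (M →ₗ[R] N) := fun a ha =>
  Module.mem_annihilator.mpr fun φ => LinearMap.ext fun x => by
    rw [LinearMap.smul_apply, ← map_smul, Module.mem_annihilator.mp (h ha), map_zero,
      LinearMap.zero_apply]

open TensorProduct in
theorem le_annihilator_tensorProduct_right (h : 𝔞 ≤ Module.annihilator R N) :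
    𝔞 ≤ Module.annihilator R (M ⊗[R] N) := fun a ha =>
  Module.mem_annihilator.mpr fun z => by
    induction z with
    | zero => rw [smul_zero]
    | add x y hx hy => rw [smul_add, hx, hy, add_zero]
    | tmul x y => rw [← TensorProduct.tmul_smul, Module.mem_annihilator.mp (h ha),
        TensorProduct.tmul_zero]

end Annihilator

section Duality

open IsLocalRing

section

variable {R : Type u} [CommRing R] {𝔞 : Ideal R} {M : Type v} [AddCommGroup M] [Module R M]
  [Module.Finite R M]

theorem exists_surjective_pi_quotient (h𝔞 : 𝔞 ≤ Module.annihilator R M) :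
    ∃ (n : ℕ) (g : (Fin n → R ⧸ 𝔞) →ₗ[R] M), Function.Surjective g := by
  have htors : Module.IsTorsionBySet R M 𝔞 :=
    fun x a => Module.mem_annihilator.mp (h𝔞 a.2) x
  let _ : Module (R ⧸ 𝔞) M := htors.module
  have : IsScalarTower R (R ⧸ 𝔞) M := htors.isScalarTower
  have : Module.Finite (R ⧸ 𝔞) M := .of_restrictScalars_finite R (R ⧸ 𝔞) M
  obtain ⟨n, g, hg⟩ := Module.Finite.exists_fin' (R ⧸ 𝔞) M
  exact ⟨n, g.restrictScalars R, hg⟩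

theorem isFiniteLength_pi (n : ℕ) {N : Type w} [AddCommGroup N] [Module R N]
    (hN : IsFiniteLength R N) : IsFiniteLength R (Fin n → N) := by
  obtain ⟨_, _⟩ := isFiniteLength_iff_isNoetherian_isArtinian.mp hN
  exact isFiniteLength_iff_isNoetherian_isArtinian.mpr ⟨inferInstance, inferInstance⟩

theorem isFiniteLength_of_le_annihilator (hfin : IsFiniteLength R (R ⧸ 𝔞))
    (h𝔞 : 𝔞 ≤ Module.annihilator R M) : IsFiniteLength R M := by
  obtain ⟨n, g, hg⟩ := exists_surjective_pi_quotient h𝔞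
  exact (isFiniteLength_pi n hfin).of_surjective hg

end

namespace IsArtinGorensteinIdeal

variable {R : Type u} [CommRing R] [IsLocalRing R] {𝔞 : Ideal R} {M : Type v} [AddCommGroup M]
  [Module R M]

theorem length_linearMap_le (h : IsArtinGorensteinIdeal 𝔞) (hM : IsFiniteLength R M) :
    Module.length R (M →ₗ[R] (R ⧸ 𝔞)) ≤ Module.length R M := by
  induction hM with
  | of_subsingleton => simp only [Module.length_eq_zero, le_refl]
  | @of_simple_quotient M _ _ N _ _ ih =>
    obtain ⟨e⟩ := nonempty_equiv_residue_of_isSimpleModule (R := R) (M ⧸ N)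
    have := h.isSimpleModule_socle
    have hsocle : Module.length R ((M ⧸ N) →ₗ[R] (R ⧸ 𝔞)) = Module.length R (M ⧸ N) := by
      rw [(LinearEquiv.congrLeft (R ⧸ 𝔞) R e).length_eq, Module.length_eq_one,
        Module.length_eq_one]
    rw [length_eq_length_add_length_quotient N, add_comm, ← hsocle]
    exact (length_le_add_of_exact (LinearMap.exact_lcomp_of_exact_of_surjective (R ⧸ 𝔞)
      (LinearMap.exact_subtype_mkQ N) N.mkQ_surjective)).trans (add_le_add_right ih _)

variable [Module.Finite R M]

/-- Dualizing `0 → K → (R/𝔞)ⁿ → M → 0` gives `n * λ(R/𝔞) ≤ λ(M*) + λ(K*)`, while duals are never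
longer than the modules themselves; so both inequalities are equalities. -/
theorem length_linearMap_eq (h : IsArtinGorensteinIdeal 𝔞) (h𝔞 : 𝔞 ≤ Module.annihilator R M) :
    Module.length R (M →ₗ[R] (R ⧸ 𝔞)) = Module.length R M := by
  refine (h.length_linearMap_le (isFiniteLength_of_le_annihilator h.isFiniteLength h𝔞)).antisymm ?_
  obtain ⟨n, g, hg⟩ := exists_surjective_pi_quotient h𝔞
  have hfin : IsFiniteLength R (LinearMap.ker g) :=
    (isFiniteLength_pi n h.isFiniteLength).of_injective (LinearMap.ker g).injective_subtype
  have hfree : Module.length R ((Fin n → R ⧸ 𝔞) →ₗ[R] (R ⧸ 𝔞)) =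
      Module.length R (Fin n → R ⧸ 𝔞) :=
    (linearMapPiQuotientEquiv (N := R ⧸ 𝔞) n Ideal.annihilator_quotient.ge).length_eq
  have hdual := length_le_add_of_exact
    (LinearMap.exact_lcomp_of_exact_of_surjective (R ⧸ 𝔞) g.exact_subtype_ker_map hg)
  rw [hfree, length_eq_length_add_length_quotient (LinearMap.ker g),
    (g.quotKerEquivOfSurjective hg).length_eq, add_comm] at hdual
  exact (ENat.add_le_add_iff_right (Module.length_ne_top_iff.mpr hfin)).mp
    (hdual.trans (add_le_add_right (h.length_linearMap_le hfin) _))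

theorem injective_applyₗ (h : IsArtinGorensteinIdeal 𝔞) (h𝔞 : 𝔞 ≤ Module.annihilator R M) :
    Function.Injective
      (LinearMap.applyₗ : M →ₗ[R] (M →ₗ[R] (R ⧸ 𝔞)) →ₗ[R] (R ⧸ 𝔞)) := by
  rw [injective_iff_map_eq_zero]
  intro x hx
  let K : Submodule R M := Submodule.span R {x}
  have hfin := (isFiniteLength_of_le_annihilator h.isFiniteLength h𝔞).of_surjective K.mkQ_surjective
  -- Every functional kills `x`, so `M/(x)` has as many functionals as `M`.
  have hsurj : Function.Surjective (LinearMap.lcomp R (R ⧸ 𝔞) K.mkQ) := fun φ =>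
    have hφ : K ≤ LinearMap.ker φ :=
      (Submodule.span_singleton_le_iff_mem _ _).mpr (LinearMap.congr_fun hx φ)
    ⟨K.liftQ φ hφ, K.liftQ_mkQ φ hφ⟩
  have hle : Module.length R M ≤ Module.length R (M ⧸ K) := by
    rw [← h.length_linearMap_eq h𝔞, ← h.length_linearMap_eq
      (h𝔞.trans (LinearMap.annihilator_le_of_surjective K.mkQ K.mkQ_surjective))]
    exact Module.length_le_of_surjective _ hsurj
  rw [length_eq_length_add_length_quotient K] at hle
  have hK : Module.length R K = 0 := le_antisymm ((ENat.add_le_add_iff_right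
    (Module.length_ne_top_iff.mpr hfin)).mp (hle.trans (zero_add _).ge)) bot_le
  rwa [Module.length_eq_zero_iff, Submodule.subsingleton_iff_eq_bot,
    Submodule.span_singleton_eq_bot] at hK

theorem bijective_applyₗ [IsNoetherianRing R] (h : IsArtinGorensteinIdeal 𝔞)
    (h𝔞 : 𝔞 ≤ Module.annihilator R M) : Function.Bijective
      (LinearMap.applyₗ : M →ₗ[R] (M →ₗ[R] (R ⧸ 𝔞)) →ₗ[R] (R ⧸ 𝔞)) := by
  have hlen : Module.length R ((M →ₗ[R] (R ⧸ 𝔞)) →ₗ[R] (R ⧸ 𝔞)) = Module.length R M := by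
    rw [h.length_linearMap_eq (le_annihilator_linearMap_of_left h𝔞), h.length_linearMap_eq h𝔞]
  have hfin := isFiniteLength_of_le_annihilator h.isFiniteLength h𝔞
  exact ⟨h.injective_applyₗ h𝔞, surjective_of_injective_of_length_le (h.injective_applyₗ h𝔞)
    hlen.le (hlen ▸ Module.length_ne_top_iff.mpr hfin)⟩

end IsArtinGorensteinIdeal

end Duality

section Conormal

open TensorProduct

variable {R : Type u} [CommRing R]

/-- With `E = R/𝔞`, this is `Hom(M ⊗ N*, E) ≅ Hom(M, N**) ≅ Hom(M, N)`, where `-* = Hom(-, E)`. -/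
theorem IsArtinGorensteinIdeal.length_tensorProduct [IsLocalRing R] [IsNoetherianRing R]
    {𝔞 : Ideal R} (h : IsArtinGorensteinIdeal 𝔞) (M : Type v) {N : Type w} [AddCommGroup M]
    [Module R M] [Module.Finite R M] [AddCommGroup N] [Module R N] [Module.Finite R N]
    (h𝔞 : 𝔞 ≤ Module.annihilator R N) :
    Module.length R (M ⊗[R] (N →ₗ[R] (R ⧸ 𝔞))) = Module.length R (M →ₗ[R] N) := by
  let e : (M →ₗ[R] N) ≃ₗ[R] (M ⊗[R] (N →ₗ[R] (R ⧸ 𝔞)) →ₗ[R] (R ⧸ 𝔞)) :=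
    (LinearEquiv.congrRight (LinearEquiv.ofBijective _ (h.bijective_applyₗ h𝔞))).trans
      (TensorProduct.lift.equiv (RingHom.id R) M (N →ₗ[R] (R ⧸ 𝔞)) (R ⧸ 𝔞))
  exact (h.length_linearMap_eq (le_annihilator_tensorProduct_right
    (le_annihilator_linearMap_of_left h𝔞))).symm.trans e.length_eq.symm

theorem bijective_lcomp_toCotangent (I : Ideal R) {N : Type v} [AddCommGroup N] [Module R N]
    (hN : I ≤ Module.annihilator R N) : Function.Bijective (LinearMap.lcomp R N I.toCotangent) :=
  ⟨LinearMap.lcomp_injective_of_surjective _ I.toCotangent_surjective, fun φ =>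
    have hφ (x y : I) : φ (x * y) = 0 :=
      (map_smul φ x.1 y).trans (Module.mem_annihilator.mp (hN x.2) _)
    ⟨Ideal.Cotangent.lift φ hφ, Ideal.Cotangent.lift_comp_toCotangent φ hφ⟩⟩

theorem nonempty_quotCanonicalModule_equiv [IsNoetherianRing R] {I : Ideal R} {ys : List R}
    (reg : IsRegular R ys) (hle : Ideal.ofList ys ≤ I) (hht : I.height.toNat = ys.length) :
    Nonempty (QuotCanonicalModule I ≃ₗ[R] ((R ⧸ I) →ₗ[R] (R ⧸ Ideal.ofList ys))) := by
  have h := nonempty_ext_length_equiv_linearMap_quotient (R ⧸ I) reg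
    (hle.trans Ideal.annihilator_quotient.ge)
  rwa [← hht] at h

theorem length_twistedConormal [IsLocalRing R] [IsNoetherianRing R] {I : Ideal R} {ys : List R}
    (reg : IsRegular R ys) (hle : Ideal.ofList ys ≤ I) (hht : I.height.toNat = ys.length)
    (h : IsArtinGorensteinIdeal (Ideal.ofList ys)) :
    Module.length R (TwistedConormal I) = Module.length R (I →ₗ[R] (R ⧸ I)) := by
  obtain ⟨e⟩ := nonempty_quotCanonicalModule_equiv reg hle hht
  have : TensorProduct.CompatibleSMul R (R ⧸ I) I.Cotangent (QuotCanonicalModule I) :=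
    .of_algebraMap_surjective _ _ Ideal.Quotient.mk_surjective
  have hfin : Module.Finite R I.Cotangent := .of_surjective _ I.toCotangent_surjective
  rw [(TensorProduct.equivOfCompatibleSMul R (R ⧸ I) R I.Cotangent
      (QuotCanonicalModule I)).length_eq,
    (TensorProduct.congr (LinearEquiv.refl R I.Cotangent) e).length_eq,
    h.length_tensorProduct I.Cotangent (hle.trans Ideal.annihilator_quotient.ge)]
  exact (LinearEquiv.ofBijective _
    (bijective_lcomp_toCotangent I Ideal.annihilator_quotient.ge)).length_eq

end Conormal

section HomOfRegularSequence

variable {R : Type u} [CommRing R] {N : Type v} [AddCommGroup N] [Module R N]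

/-- The values of `φ` on `F` and `n` at `x` are compatible: if `c * x ∈ F` then `c ∈ F`, so
`φ (c * x) = x • φ c = 0 = c • n`. -/
theorem exists_linearMap_sup_span_singleton {F : Ideal R} {x : R} (hx : IsSMulRegular (R ⧸ F) x)
    (hN : F ⊔ Ideal.span {x} ≤ Module.annihilator R N) (φ : F →ₗ[R] N) (n : N) :
    ∃ φ' : ↥(F ⊔ Ideal.span {x}) →ₗ[R] N,
      φ' ∘ₗ Submodule.inclusion le_sup_left = φ ∧
        φ' ⟨x, Submodule.mem_sup_right (Ideal.mem_span_singleton_self x)⟩ = n := by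
  have hmem (c : R) (hc : c * x ∈ F) : c ∈ F :=
    (isSMulRegular_quotient_iff_mem_of_smul_mem _ _).mp hx c (by rwa [smul_eq_mul, mul_comm])
  have hkill (c : R) (hc : c ∈ F) : c • n = 0 :=
    Module.mem_annihilator.mp (hN (Submodule.mem_sup_left hc)) n
  let f : R →ₗ.[R] N := ⟨F, φ⟩
  let g : R →ₗ.[R] N := LinearPMap.mkSpanSingleton' x n fun c hc =>
    hkill c (hmem c (by rw [← smul_eq_mul, hc]; exact F.zero_mem))
  have hfg (y : f.domain) (z : g.domain) (hyz : (y : R) = z) : f y = g z := by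
    obtain ⟨z, hz⟩ := z
    obtain ⟨c, rfl⟩ := Submodule.mem_span_singleton.mp hz
    have hc : c ∈ F := hmem c ((show (y : R) = c * x from hyz) ▸ y.2)
    have hy : y = x • (⟨c, hc⟩ : F) := Subtype.ext (hyz.trans (mul_comm c x))
    have hfy : f y = 0 := by
      rw [hy]
      exact (map_smul φ x _).trans (Module.mem_annihilator.mp
        (hN (Submodule.mem_sup_right (Ideal.mem_span_singleton_self x))) _)
    exact hfy.trans ((LinearPMap.mkSpanSingleton'_apply x n _ c _).trans (hkill c hc)).symm
  refine ⟨(f.sup g hfg).toFun, LinearMap.ext fun y => ?_, ?_⟩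
  · exact (LinearPMap.left_le_sup f g hfg).2 rfl |>.symm
  · refine ((LinearPMap.right_le_sup f g hfg).2 (x := ⟨x, Submodule.mem_span_singleton_self x⟩)
      rfl).symm.trans (LinearPMap.mkSpanSingleton'_apply_self x n _ _)

theorem exists_linearMap_ofList_forall_apply_eq {xs : List R} (reg : IsWeaklyRegular R xs)
    (hN : Ideal.ofList xs ≤ Module.annihilator R N) (v : ℕ → N) :
    ∃ φ : Ideal.ofList xs →ₗ[R] N, ∀ (i : ℕ) (hi : i < xs.length)
      (hmem : xs[i] ∈ Ideal.ofList xs), φ ⟨xs[i], hmem⟩ = v i := by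
  induction xs using List.reverseRecOn with
  | nil => exact ⟨0, fun i hi => absurd hi (Nat.not_lt_zero i)⟩
  | append_singleton xs x ih =>
    rw [isWeaklyRegular_append_iff, isWeaklyRegular_singleton_iff] at reg
    have hsup : Ideal.ofList (xs ++ [x]) = Ideal.ofList xs ⊔ Ideal.span {x} := by
      rw [Ideal.ofList_append, Ideal.ofList_singleton]
    have hx : IsSMulRegular (R ⧸ Ideal.ofList xs) x := by
      have h := reg.2
      rwa [Ideal.smul_top_eq_map, Algebra.algebraMap_self, Ideal.map_id] at h
    obtain ⟨φ, hφ⟩ := ih reg.1 ((le_sup_left.trans hsup.ge).trans hN)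
    obtain ⟨φ', hres, hlast⟩ :=
      exists_linearMap_sup_span_singleton hx (hsup.ge.trans hN) φ (v xs.length)
    refine ⟨φ' ∘ₗ Submodule.inclusion hsup.le, fun i hi hmem => ?_⟩
    rcases Nat.lt_or_ge i xs.length with hlt | hge
    · have hmem' : xs[i] ∈ Ideal.ofList xs := Ideal.subset_span (xs.getElem_mem hlt)
      rw [← hφ i hlt hmem', ← hres]
      exact congrArg φ' (Subtype.ext (List.getElem_append_left hlt))
    · obtain rfl : i = xs.length := by
        rw [List.length_append, List.length_singleton] at hi
        lia
      rw [← hlast]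
      exact congrArg φ' (Subtype.ext (List.getElem_concat_length rfl _))

/-- The surjection `Rⁿ → (xs)` defined by the generators `xs`. -/
def combinationOfList (xs : List R) : (Fin xs.length → R) →ₗ[R] Ideal.ofList xs :=
  Fintype.linearCombination R fun i => ⟨xs[i], Ideal.subset_span (xs.getElem_mem i.2)⟩

theorem surjective_combinationOfList (xs : List R) :
    Function.Surjective (combinationOfList xs) := by
  rw [← LinearMap.range_eq_top, combinationOfList, Fintype.range_linearCombination,
    ← (Submodule.map_injective_of_injective (Submodule.injective_subtype _)).eq_iff,
    Submodule.map_span, Submodule.map_top, Submodule.range_subtype, ← Set.range_comp]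
  exact congrArg Ideal.span (Set.range_list_get xs)

theorem exists_linearMap_ofList_comp_eq {xs : List R} (reg : IsWeaklyRegular R xs)
    (hN : Ideal.ofList xs ≤ Module.annihilator R N) (f : (Fin xs.length → R) →ₗ[R] N) :
    ∃ φ : Ideal.ofList xs →ₗ[R] N, φ ∘ₗ combinationOfList xs = f := by
  obtain ⟨φ, hφ⟩ := exists_linearMap_ofList_forall_apply_eq reg hN
    fun i => if h : i < xs.length then f (Pi.single ⟨i, h⟩ 1) else 0
  refine ⟨φ, LinearMap.pi_ext' fun i => LinearMap.ext_ring ?_⟩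
  have hi := (hφ i i.2 (Ideal.subset_span (xs.getElem_mem i.2))).trans (dif_pos i.2)
  simpa [combinationOfList] using hi

theorem length_linearMap_ofList {xs : List R} (reg : IsWeaklyRegular R xs)
    (hN : Ideal.ofList xs ≤ Module.annihilator R N) :
    Module.length R (Ideal.ofList xs →ₗ[R] N) = xs.length * Module.length R N := by
  let e : (Ideal.ofList xs →ₗ[R] N) ≃ₗ[R] (Fin xs.length → N) :=
    (LinearEquiv.ofBijective (LinearMap.lcomp R N (combinationOfList xs))
      ⟨LinearMap.lcomp_injective_of_surjective _ (surjective_combinationOfList xs),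
        exists_linearMap_ofList_comp_eq reg hN⟩).trans
          (LinearEquiv.piRing R N (Fin xs.length) R)
  rw [e.length_eq, Module.length_pi_of_fintype, Finset.sum_const, Finset.card_univ,
    Fintype.card_fin, nsmul_eq_mul]

open TensorProduct

/-- An inverse `N ⊗ (xs) → N ⊗ Rⁿ` comes from the map `(xs) → Hom(N, N ⊗ Rⁿ)` sending `∑ vᵢ xᵢ` to
`n ↦ n ⊗ v`. -/
theorem bijective_lTensor_combinationOfList {xs : List R} (reg : IsWeaklyRegular R xs)
    (hN : Ideal.ofList xs ≤ Module.annihilator R N) :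
    Function.Bijective ((combinationOfList xs).lTensor N) := by
  obtain ⟨φ, hφ⟩ := exists_linearMap_ofList_comp_eq reg (le_annihilator_linearMap_of_left hN)
    (TensorProduct.mk R N (Fin xs.length → R)).flip
  have hinv : TensorProduct.lift φ.flip ∘ₗ (combinationOfList xs).lTensor N = LinearMap.id :=
    TensorProduct.ext' fun n v => LinearMap.congr_fun (LinearMap.congr_fun hφ v) n
  exact ⟨Function.LeftInverse.injective (LinearMap.congr_fun hinv),
    LinearMap.lTensor_surjective N (surjective_combinationOfList xs)⟩

theorem injective_rTensor_ofList {xs : List R} (reg : IsWeaklyRegular R xs) {P : Type w}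
    [AddCommGroup P] [Module R P] (hN : Ideal.ofList xs ≤ Module.annihilator R N)
    (hP : Ideal.ofList xs ≤ Module.annihilator R P) {f : N →ₗ[R] P} (hf : Function.Injective f) :
    Function.Injective (f.rTensor (Ideal.ofList xs)) := by
  refine Function.Injective.of_comp_right ?_ (bijective_lTensor_combinationOfList reg hN).2
  rw [← LinearMap.coe_comp, LinearMap.rTensor_comp_lTensor, ← LinearMap.lTensor_comp_rTensor]
  exact (bijective_lTensor_combinationOfList reg hP).1.comp
    (Module.Flat.rTensor_preserves_injective_linearMap f hf)

theorem length_tensorProduct_ofList {xs : List R} (reg : IsWeaklyRegular R xs)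
    (hN : Ideal.ofList xs ≤ Module.annihilator R N) :
    Module.length R (N ⊗[R] Ideal.ofList xs) = xs.length * Module.length R N := by
  rw [← (LinearEquiv.ofBijective _ (bijective_lTensor_combinationOfList reg hN)).length_eq,
    (TensorProduct.piScalarRight R R N (Fin xs.length)).length_eq, Module.length_pi_of_fintype,
    Finset.sum_const, Finset.card_univ, Fintype.card_fin, nsmul_eq_mul]

end HomOfRegularSequence

section Linkage

open TensorProduct

variable {R : Type u} [CommRing R] {F I J : Ideal R}

theorem exact_inclusion_submoduleMap (hI : F ≤ I) :
    Function.Exact (Submodule.inclusion hI) (F.mkQ.submoduleMap I) := by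
  refine fun x => ⟨fun hx => ?_, ?_⟩
  · exact ⟨⟨x, (Submodule.Quotient.mk_eq_zero F).mp (congrArg Subtype.val hx)⟩, rfl⟩
  · rintro ⟨y, rfl⟩
    exact Subtype.ext ((Submodule.Quotient.mk_eq_zero F).mpr y.2)

theorem length_range_eq_of_ker_eq {M N P : Type*} [AddCommGroup M] [AddCommGroup N]
    [AddCommGroup P] [Module R M] [Module R N] [Module R P] {f : M →ₗ[R] N} {g : M →ₗ[R] P}
    (hg : Function.Surjective g) (h : LinearMap.ker f = LinearMap.ker g) :
    Module.length R (LinearMap.range f) = Module.length R P :=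
  (f.quotKerEquivRange.symm.trans <| (Submodule.quotEquivOfEq _ _ h).trans <|
    g.quotKerEquivOfSurjective hg).length_eq

/-- The module `(I ⊗ J) / im (F ⊗ F)`. It is symmetric in `I` and `J`, while its length, computed
from the surjection onto `I ⊗ (J/F)`, is not visibly so. -/
abbrev LinkageTensor (hI : F ≤ I) (hJ : F ≤ J) : Type u :=
  (I ⊗[R] J) ⧸
    LinearMap.range (TensorProduct.map (Submodule.inclusion hI) (Submodule.inclusion hJ))

namespace LinkageTensor

theorem length_comm (hI : F ≤ I) (hJ : F ≤ J) :
    Module.length R (LinkageTensor hI hJ) = Module.length R (LinkageTensor hJ hI) := by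
  refine (Submodule.Quotient.equiv _ _ (TensorProduct.comm R I J) ?_).length_eq
  rw [← LinearMap.range_comp]
  exact (congrArg LinearMap.range (TensorProduct.map_comp_comm_eq _ _)).symm.trans
    (LinearMap.range_comp_of_range_eq_top _ (TensorProduct.comm R F F).range)

variable (hI : F ≤ I) (hJ : F ≤ J)

/-- The map `I ⊗ F → (I ⊗ J) / im (F ⊗ F)` induced by `F ≤ J`. -/
abbrev ofTensor : I ⊗[R] F →ₗ[R] LinkageTensor hI hJ :=
  (LinearMap.range (TensorProduct.map (Submodule.inclusion hI) (Submodule.inclusion hJ))).mkQ ∘ₗ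
    (Submodule.inclusion hJ).lTensor I

theorem length_eq_length_range_ofTensor_add : Module.length R (LinkageTensor hI hJ) =
    Module.length R (LinearMap.range (ofTensor hI hJ)) +
      Module.length R (I ⊗[R] Submodule.map F.mkQ J) := by
  have hle : LinearMap.range
      (TensorProduct.map (Submodule.inclusion hI) (Submodule.inclusion hJ)) ≤
        LinearMap.range ((Submodule.inclusion hJ).lTensor I) := by
    rw [← LinearMap.lTensor_comp_rTensor]
    exact LinearMap.range_comp_le_range _ _
  have hker : LinearMap.ker ((F.mkQ.submoduleMap J).lTensor I) =
      LinearMap.range ((Submodule.inclusion hJ).lTensor I) :=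
    (lTensor_exact I (exact_inclusion_submoduleMap hJ)
      (F.mkQ.submoduleMap_surjective J)).linearMap_ker_eq
  rw [length_eq_length_add_length_quotient (LinearMap.range (ofTensor hI hJ)),
    ← ((F.mkQ.submoduleMap J).lTensor I).quotKerEquivOfSurjective
      (LinearMap.lTensor_surjective I (F.mkQ.submoduleMap_surjective J)) |>.length_eq,
    (Submodule.quotEquivOfEq _ _ hker).length_eq, LinearMap.range_comp,
    (Submodule.quotientQuotientEquivQuotient _ _ hle).length_eq]

/-- The multiplication `I ⊗ J → F`, followed by `F → (R/F) ⊗ F`, kills the image of `F ⊗ F`. -/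
theorem exists_comp_ofTensor_eq (hIJ : I * J ≤ F) :
    ∃ ψ : LinkageTensor hI hJ →ₗ[R] (R ⧸ F) ⊗[R] F, ψ ∘ₗ ofTensor hI hJ =
      (Submodule.map F.mkQ I).subtype.rTensor F ∘ₗ (F.mkQ.submoduleMap I).rTensor F := by
  let mul : I ⊗[R] J →ₗ[R] F :=
    (TensorProduct.lift ((LinearMap.mul R R).domRestrict₁₂ I J)).codRestrict F fun z => by
      induction z with
      | zero => rw [map_zero]; exact F.zero_mem
      | add x y hx hy => rw [map_add]; exact F.add_mem hx hy
      | tmul x y => exact hIJ (Ideal.mul_mem_mul x.2 y.2)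
  have mk_smul (a : R) (b : F) : TensorProduct.mk R (R ⧸ F) F 1 (a • b) = F.mkQ a ⊗ₜ b := by
    rw [TensorProduct.mk_apply, ← TensorProduct.smul_tmul, ← Algebra.algebraMap_eq_smul_one]
    rfl
  refine ⟨Submodule.liftQ _ (TensorProduct.mk R (R ⧸ F) F 1 ∘ₗ mul) ?_, ?_⟩
  · rw [LinearMap.range_le_ker_iff]
    refine TensorProduct.ext' fun a b => ?_
    have ha : F.mkQ a = 0 := (Submodule.Quotient.mk_eq_zero F).mpr a.2
    exact (mk_smul a b).trans (by rw [ha, TensorProduct.zero_tmul, LinearMap.zero_apply])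
  · exact TensorProduct.ext' fun a b => mk_smul a b

theorem ker_ofTensor {xs : List R} (reg : IsWeaklyRegular R xs) (hI : Ideal.ofList xs ≤ I)
    (hJ : Ideal.ofList xs ≤ J) (hIJ : I * J ≤ Ideal.ofList xs) :
    LinearMap.ker (ofTensor hI hJ) =
      LinearMap.ker (((Ideal.ofList xs).mkQ.submoduleMap I).rTensor (Ideal.ofList xs)) := by
  set F := Ideal.ofList xs
  refine le_antisymm (fun z hz => ?_) ?_
  · have hR : F ≤ Module.annihilator R (R ⧸ F) := Ideal.annihilator_quotient.ge
    have hinj : Function.Injective ((Submodule.map F.mkQ I).subtype.rTensor F) :=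
      injective_rTensor_ofList reg (hR.trans (LinearMap.annihilator_le_of_injective _
        (Submodule.injective_subtype _))) hR (Submodule.injective_subtype _)
    obtain ⟨ψ, hψ⟩ := exists_comp_ofTensor_eq hI hJ hIJ
    refine LinearMap.mem_ker.mpr (hinj ?_)
    rw [← LinearMap.comp_apply, ← hψ, LinearMap.comp_apply, LinearMap.mem_ker.mp hz, map_zero,
      map_zero]
  · rw [(rTensor_exact F (exact_inclusion_submoduleMap hI)
      (F.mkQ.submoduleMap_surjective I)).linearMap_ker_eq, LinearMap.range_le_ker_iff]
    refine TensorProduct.ext' fun a b => ?_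
    exact (Submodule.Quotient.mk_eq_zero _).mpr ⟨a ⊗ₜ b, rfl⟩

theorem length_eq {xs : List R} (reg : IsWeaklyRegular R xs) (hI : Ideal.ofList xs ≤ I)
    (hJ : Ideal.ofList xs ≤ J) (hIJ : I * J ≤ Ideal.ofList xs) :
    Module.length R (LinkageTensor hI hJ) =
      xs.length * Module.length R (Submodule.map (Ideal.ofList xs).mkQ I) +
        Module.length R (I ⊗[R] Submodule.map (Ideal.ofList xs).mkQ J) := by
  have hann : Ideal.ofList xs ≤
      Module.annihilator R (Submodule.map (Ideal.ofList xs).mkQ I) :=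
    Ideal.annihilator_quotient.ge.trans
      (LinearMap.annihilator_le_of_injective _ (Submodule.injective_subtype _))
  rw [length_eq_length_range_ofTensor_add, ← length_tensorProduct_ofList reg hann,
    length_range_eq_of_ker_eq
      (P := Submodule.map (Ideal.ofList xs).mkQ I ⊗[R] Ideal.ofList xs)
      (LinearMap.rTensor_surjective _ ((Ideal.ofList xs).mkQ.submoduleMap_surjective I))
      (ker_ofTensor reg hI hJ hIJ)]

end LinkageTensor

theorem map_mkQ_colon (I F : Ideal R) :
    Submodule.map F.mkQ (F.colon (I : Set R)) = Submodule.torsionBySet R (R ⧸ F) I := by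
  ext z
  obtain ⟨r, rfl⟩ := F.mkQ_surjective z
  have hle : F ≤ F.colon (I : Set R) := fun a ha =>
    Submodule.mem_colon.mpr fun _ _ => F.mul_mem_right _ ha
  rw [← Submodule.mem_comap, Submodule.comap_map_eq_self (F.ker_mkQ.trans_le hle),
    Submodule.mem_colon, Submodule.mem_torsionBySet_iff]
  refine ⟨fun h a => ?_, fun h a ha => ?_⟩
  · rw [← map_smul, Submodule.mkQ_apply, Submodule.Quotient.mk_eq_zero, smul_eq_mul, mul_comm]
    exact h a a.2
  · rw [smul_eq_mul, mul_comm]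
    exact (Submodule.Quotient.mk_eq_zero F).mp (h ⟨a, ha⟩)

theorem LinkageTensor.length_eq_of_eq_colon [IsLocalRing R] [IsNoetherianRing R] {xs : List R}
    (reg : IsWeaklyRegular R xs)
    (h𝔞 : IsArtinGorensteinIdeal (Ideal.ofList xs)) (hI : Ideal.ofList xs ≤ I)
    (hJ : Ideal.ofList xs ≤ J) (hJI : J = (Ideal.ofList xs).colon (I : Set R))
    (hIJ : I = (Ideal.ofList xs).colon (J : Set R)) :
    Module.length R (LinkageTensor hI hJ) =
      xs.length * Module.length R (R ⧸ J) + Module.length R (I →ₗ[R] (R ⧸ I)) := by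
  have hmul : I * J ≤ Ideal.ofList xs := Ideal.mul_le.mpr fun a ha b hb =>
    Submodule.mem_colon.mp (hIJ.le ha) b hb
  have dual {K L : Ideal R} (hKL : L = (Ideal.ofList xs).colon (K : Set R)) :
      Nonempty (Submodule.map (Ideal.ofList xs).mkQ L ≃ₗ[R]
        ((R ⧸ K) →ₗ[R] (R ⧸ Ideal.ofList xs))) := by
    rw [hKL, map_mkQ_colon]
    exact ⟨(linearMapQuotientEquivTorsionBySet K (R ⧸ Ideal.ofList xs)).symm⟩
  obtain ⟨eI⟩ := dual hIJ
  obtain ⟨eJ⟩ := dual hJI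
  rw [LinkageTensor.length_eq reg hI hJ hmul, eI.length_eq,
    h𝔞.length_linearMap_eq (hJ.trans Ideal.annihilator_quotient.ge),
    (eJ.lTensor I).length_eq,
    h𝔞.length_tensorProduct I (hI.trans Ideal.annihilator_quotient.ge)]

theorem length_linearMap_add_of_link [IsLocalRing R] [IsNoetherianRing R] {xs : List R}
    (reg : IsWeaklyRegular R xs) (h𝔞 : IsArtinGorensteinIdeal (Ideal.ofList xs))
    (hI : Ideal.ofList xs ≤ I) (hJ : Ideal.ofList xs ≤ J)
    (hJI : J = (Ideal.ofList xs).colon (I : Set R))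
    (hIJ : I = (Ideal.ofList xs).colon (J : Set R)) :
    xs.length * Module.length R (R ⧸ J) + Module.length R (I →ₗ[R] (R ⧸ I)) =
      xs.length * Module.length R (R ⧸ I) + Module.length R (J →ₗ[R] (R ⧸ J)) := by
  rw [← LinkageTensor.length_eq_of_eq_colon reg h𝔞 hI hJ hJI hIJ, LinkageTensor.length_comm,
    LinkageTensor.length_eq_of_eq_colon reg h𝔞 hJ hI hIJ hJI]

end Linkage

section Licci

variable {R : Type u} [CommRing R] [IsGorensteinLocalRing R]

/-- Otherwise `Hom(R/I, R/(xs)) ≅ Ext(R/I, R)` vanishes, so that multiplication by an element of `J`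
is the zero map `R/I → R/(xs)`. -/
theorem IsGorensteinLocalRing.ringKrullDim_eq_length_of_link {I J : Ideal R} {xs : List R}
    (reg : IsRegular R xs) (hI : I ≠ ⊤) (hfin : IsFiniteLength R (R ⧸ I))
    (hxs : Ideal.ofList xs ≤ I) (hIJ : I = (Ideal.ofList xs).colon (J : Set R)) :
    ringKrullDim R = xs.length := by
  obtain ⟨ys, regy, hy, -⟩ := IsGorensteinLocalRing.exists_isRegular_of_isFiniteLength hI hfin
  have hle : xs.length ≤ ys.length :=
    Nat.cast_le.mp ((length_le_ringKrullDim_of_isRegular reg).trans_eq hy)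
  rw [hy, Nat.cast_inj]
  refine (hle.antisymm (not_lt.mp fun hlt => hI ?_)).symm
  have := subsingleton_ext_of_isFiniteLength regy hlt hfin
  obtain ⟨e⟩ := nonempty_ext_length_equiv_linearMap_quotient (R ⧸ I) reg
    (hxs.trans Ideal.annihilator_quotient.ge)
  have hsub : Subsingleton ((R ⧸ I) →ₗ[R] (R ⧸ Ideal.ofList xs)) := e.symm.toEquiv.subsingleton
  rw [(Ideal.eq_top_iff_one _), hIJ, Submodule.mem_colon]
  intro j hj
  have hker : I ≤ LinearMap.ker (LinearMap.toSpanSingleton R _ ((Ideal.ofList xs).mkQ j)) := by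
    intro a ha
    rw [LinearMap.mem_ker, LinearMap.toSpanSingleton_apply, ← map_smul]
    exact (Submodule.Quotient.mk_eq_zero _).mpr (Submodule.mem_colon.mp (hIJ.le ha) j hj)
  have hzero := LinearMap.congr_fun (hsub.elim (I.liftQ _ hker) 0) (I.mkQ 1)
  change (1 : R) • (Ideal.ofList xs).mkQ j = 0 at hzero
  rw [← map_smul] at hzero
  exact (Submodule.Quotient.mk_eq_zero _).mp hzero

theorem IsLicci.length_linearMap_eq {d : ℕ} (hd : ringKrullDim R = d) {I : Ideal R}
    (h : IsLicci I) (hfin : IsFiniteLength R (R ⧸ I)) :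
    Module.length R (I →ₗ[R] (R ⧸ I)) = d * Module.length R (R ⧸ I) := by
  obtain ⟨C, hchain, xs, reg, rfl⟩ := h
  induction hchain using Relation.ReflTransGen.head_induction_on with
  | refl =>
    have hlen : d = xs.length :=
      Nat.cast_inj.mp (hd.symm.trans ((isFiniteLength_quotient_ofList_iff reg).mp hfin))
    rw [length_linearMap_ofList reg.toIsWeaklyRegular Ideal.annihilator_quotient.ge, hlen]
  | @head I J hlink _ ih =>
    obtain ⟨hI, -, ys, regy, hle, hJI, hIJ⟩ := hlink
    obtain ⟨hysI, hysJ⟩ := le_inf_iff.mp hle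
    have hdim := IsGorensteinLocalRing.ringKrullDim_eq_length_of_link regy hI hfin hysI hIJ
    have hlen : ys.length = d := Nat.cast_inj.mp (hdim.symm.trans hd)
    have hfinJ : IsFiniteLength R (R ⧸ J) := .of_surjective
      ((isFiniteLength_quotient_ofList_iff regy).mpr hdim) (Submodule.factor_surjective hysJ)
    have key := length_linearMap_add_of_link regy.toIsWeaklyRegular
      (IsGorensteinLocalRing.isArtinGorensteinIdeal_ofList regy hdim) hysI hysJ hJI hIJ
    rw [ih hfinJ, hlen, add_comm] at key
    have hne : (d : ℕ∞) * Module.length R (R ⧸ J) ≠ ⊤ :=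
      WithTop.mul_ne_top (ENat.natCast_ne_top d) (Module.length_ne_top_iff.mpr hfinJ)
    exact ENat.add_left_injective_of_ne_top hne key

end Licci

section Reduction

open IsLocalRing

variable {R : Type u} [CommRing R]

theorem height_eq_ringKrullDim_of_isFiniteLength [IsLocalRing R] [IsNoetherianRing R] {I : Ideal R}
    (hI : I ≠ ⊤) (hfin : IsFiniteLength R (R ⧸ I)) : (I.height : WithBot ℕ∞) = ringKrullDim R := by
  refine le_antisymm (Ideal.height_le_ringKrullDim_of_ne_top hI) ?_
  rw [← maximalIdeal_height_eq_ringKrullDim, WithBot.coe_le_coe,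
    Ideal.height_eq_inf_minimalPrimes I]
  refine le_iInf₂ fun p hp => ?_
  have hmax : p.IsMaximal := Ideal.krullDimLE_zero_quotient_iff_forall_minimalPrimes_isMaximal.mp
    (isFiniteLength_quotient_iff_krullDimLE_zero.mp hfin) p hp
  rw [eq_maximalIdeal hmax]

theorem conormalInequality_iff [IsLocalRing R] [IsNoetherianRing R] {I : Ideal R} (hI : I ≠ ⊤)
    {ys : List R} (reg : IsRegular R ys) (hle : Ideal.ofList ys ≤ I)
    (h : IsArtinGorensteinIdeal (Ideal.ofList ys)) :
    ConormalInequality I ↔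
      ys.length * Module.length R (R ⧸ I) ≤ Module.length R (I →ₗ[R] (R ⧸ I)) := by
  have hfin : IsFiniteLength R (R ⧸ I) :=
    h.isFiniteLength.of_surjective (Submodule.factor_surjective hle)
  have hdim : ringKrullDim R = ys.length :=
    (isFiniteLength_quotient_ofList_iff reg).mp h.isFiniteLength
  have hheight : I.height = (ys.length : ℕ∞) := by
    exact_mod_cast (height_eq_ringKrullDim_of_isFiniteLength hI hfin).trans hdim
  rw [ConormalInequality, length_twistedConormal reg hle
    (by rw [hheight, ENat.toNat_natCast]) h, hdim, ← WithBot.coe_natCast, ← WithBot.coe_mul,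
    WithBot.coe_le_coe]

theorem conormalInequality_top : ConormalInequality (⊤ : Ideal R) := by
  have : Subsingleton (R ⧸ (⊤ : Ideal R)) := Ideal.Quotient.subsingleton_iff.mpr rfl
  rw [ConormalInequality, Module.length_eq_zero, WithBot.coe_zero, mul_zero]
  exact WithBot.coe_nonneg.mpr bot_le

end Reduction

section Surjection

variable {R : Type u} {Q : Type v} [CommRing R] [CommRing Q] [Algebra Q R]
  (hπ : Function.Surjective (algebraMap Q R))

include hπ

theorem nonempty_quotient_comap_equiv (I : Ideal R) :
    Nonempty ((Q ⧸ I.comap (algebraMap Q R)) ≃ₗ[Q] (R ⧸ I)) := by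
  have hker : I.comap (algebraMap Q R) =
      LinearMap.ker (I.mkQ.restrictScalars Q ∘ₗ Algebra.linearMap Q R) :=
    Ideal.ext fun _ => (Ideal.Quotient.eq_zero_iff_mem (I := I)).symm
  exact ⟨(Submodule.quotEquivOfEq _ _ hker).trans
    (LinearMap.quotKerEquivOfSurjective _ (I.mkQ_surjective.comp hπ))⟩

theorem length_quotient_comap (I : Ideal R) :
    Module.length Q (Q ⧸ I.comap (algebraMap Q R)) = Module.length R (R ⧸ I) := by
  obtain ⟨e⟩ := nonempty_quotient_comap_equiv hπ I
  rw [e.length_eq, Module.length_eq_of_surjective hπ]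

variable {M N : Type*} [AddCommGroup M] [AddCommGroup N] [Module R M] [Module R N] [Module Q M]
  [Module Q N] [IsScalarTower Q R M] [IsScalarTower Q R N]

theorem length_linearMap_restrictScalars :
    Module.length Q (M →ₗ[Q] N) = Module.length R (M →ₗ[R] N) := by
  rw [← Module.length_eq_of_surjective hπ (M := M →ₗ[R] N)]
  let e : (M →ₗ[R] N) ≃ₗ[Q] (M →ₗ[Q] N) :=
    { LinearMap.restrictScalarsₗ Q R M N Q with
      invFun := fun f => f.extendScalarsOfSurjective hπ
      left_inv := fun _ => rfl
      right_inv := fun _ => rfl }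
  exact e.length_eq.symm

theorem length_linearMap_quotient_comap (I J : Ideal R) :
    Module.length Q ((Q ⧸ I.comap (algebraMap Q R)) →ₗ[Q] (Q ⧸ J.comap (algebraMap Q R))) =
      Module.length R ((R ⧸ I) →ₗ[R] (R ⧸ J)) := by
  obtain ⟨eI⟩ := nonempty_quotient_comap_equiv hπ I
  obtain ⟨eJ⟩ := nonempty_quotient_comap_equiv hπ J
  rw [← length_linearMap_restrictScalars hπ, (eI.arrowCongr eJ).length_eq]

theorem surjective_idealMap (J : Ideal Q) : Function.Surjective (Algebra.idealMap R J) := by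
  rintro ⟨x, hx⟩
  obtain ⟨j, hj, rfl⟩ := (Ideal.mem_map_iff_of_surjective _ hπ).mp hx
  exact ⟨⟨j, hj⟩, rfl⟩

theorem length_submodule_linearMap_le {J : Ideal Q} (U : Submodule Q (J →ₗ[Q] N))
    (hU : ∀ φ ∈ U, ∀ j : J, algebraMap Q R j = 0 → φ j = 0) :
    Module.length Q U ≤ Module.length R (J.map (algebraMap Q R) →ₗ[R] N) := by
  let τ : J →ₗ[Q] J.map (algebraMap Q R) := Algebra.idealMap R J
  have hfactor : U ≤ LinearMap.range (LinearMap.lcomp Q N τ) := fun φ hφ =>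
    (LinearMap.exact_lcomp_of_exact_of_surjective N τ.exact_subtype_ker_map
      (surjective_idealMap hπ J) φ).mp <| LinearMap.ext fun j =>
        hU φ hφ j (congrArg Subtype.val j.2)
  rw [← length_linearMap_restrictScalars hπ]
  exact (Module.length_le_of_injective _ (Submodule.inclusion_injective hfactor)).trans
    (Module.length_le_of_surjective _ (LinearMap.surjective_rangeRestrict _))

end Surjection

section Deformation

open IsLocalRing

variable {R : Type u} {Q : Type v} [CommRing R] [CommRing Q]

theorem ofList_append_eq_comap {π : Q →+* R} (hπ : Function.Surjective π) {xs : List Q}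
    (hker : RingHom.ker π = Ideal.ofList xs) (zs : List Q) :
    Ideal.ofList (xs ++ zs) = (Ideal.ofList (zs.map π)).comap π := by
  rw [← Ideal.map_ofList, Ideal.comap_map_of_surjective _ hπ, ← RingHom.ker_eq_comap_bot, hker,
    Ideal.ofList_append, sup_comm]

variable [Algebra Q R] (hπ : Function.Surjective (algebraMap Q R))

include hπ

theorem isRegular_append_of_surjective {xs zs : List Q} (regx : IsRegular Q xs)
    (hker : RingHom.ker (algebraMap Q R) = Ideal.ofList xs)
    (regz : IsRegular R (zs.map (algebraMap Q R))) : IsRegular Q (xs ++ zs) := by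
  refine ⟨(isWeaklyRegular_append_iff Q xs zs).mpr ⟨regx.toIsWeaklyRegular, ?_⟩, fun h => ?_⟩
  · have hf : LinearMap.ker (Algebra.linearMap Q R) = Ideal.ofList xs • (⊤ : Submodule Q Q) := by
      rw [smul_eq_mul, Ideal.mul_top, ← hker]
      rfl
    let e : (Q ⧸ (Ideal.ofList xs • (⊤ : Submodule Q Q))) ≃ₗ[Q] R :=
      (Submodule.quotEquivOfEq _ _ hf.symm).trans (LinearMap.quotKerEquivOfSurjective _ hπ)
    rw [e.isWeaklyRegular_congr]
    exact (isWeaklyRegular_map_algebraMap_iff R R zs).mp regz.toIsWeaklyRegular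
  · rw [smul_eq_mul, Ideal.mul_top, ofList_append_eq_comap hπ hker, eq_comm,
      Ideal.comap_eq_top_iff] at h
    exact ofList_ne_top_of_isRegular regz h

theorem IsArtinGorensteinIdeal.comap [IsLocalRing Q] [IsLocalRing R] {𝔞 : Ideal R}
    (h : IsArtinGorensteinIdeal 𝔞) : IsArtinGorensteinIdeal (𝔞.comap (algebraMap Q R)) where
  isFiniteLength := by
    rw [← Module.length_ne_top_iff, length_quotient_comap hπ]
    exact Module.length_ne_top_iff.mpr h.isFiniteLength
  isSimpleModule_socle := by
    have := IsLocalHom.of_surjective (algebraMap Q R) hπ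
    rw [← maximalIdeal_comap (algebraMap Q R), ← Module.length_eq_one_iff,
      length_linearMap_quotient_comap hπ, Module.length_eq_one_iff]
    exact h.isSimpleModule_socle

theorem length_linearMap_comap_le {xs : List Q}
    (hker : RingHom.ker (algebraMap Q R) = Ideal.ofList xs) (I : Ideal R) :
    Module.length Q (I.comap (algebraMap Q R) →ₗ[Q] (Q ⧸ I.comap (algebraMap Q R))) ≤
      Module.length R (I →ₗ[R] (R ⧸ I)) + xs.length * Module.length R (R ⧸ I) := by
  have hle : Ideal.ofList xs ≤ I.comap (algebraMap Q R) :=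
    hker ▸ RingHom.ker_eq_comap_bot (algebraMap Q R) ▸ Ideal.comap_mono bot_le
  obtain ⟨e⟩ := nonempty_quotient_comap_equiv hπ I
  rw [((LinearEquiv.refl Q _).arrowCongr e).length_eq]
  let res := LinearMap.lcomp Q (R ⧸ I) (Submodule.inclusion hle)
  refine (length_le_length_ker_add res).trans (add_le_add ?_ ?_)
  · have hker_le := length_submodule_linearMap_le hπ (LinearMap.ker res) fun φ hφ j hj =>
      LinearMap.congr_fun hφ ⟨j, hker.le hj⟩
    rwa [Ideal.map_comap_of_surjective _ hπ] at hker_le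
  · have hinj := LinearMap.lcomp_injective_of_surjective (S := Q) (N := R ⧸ I) _
      (surjective_combinationOfList xs)
    refine (Module.length_le_of_injective _ hinj).trans_eq ?_
    rw [(LinearEquiv.piRing Q (R ⧸ I) _ Q).length_eq, Module.length_pi_of_fintype,
      Finset.sum_const, Finset.card_univ, Fintype.card_fin, nsmul_eq_mul,
      Module.length_eq_of_surjective hπ]

omit [Algebra Q R] hπ in
theorem ConormalInequality.of_deformsAlong [IsGorensteinLocalRing R] {I : Ideal R}
    (hfin : IsFiniteLength R (R ⧸ I)) [IsLocalRing Q] [IsNoetherianRing Q] {π : Q →+* R}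
    (hdef : DeformsAlong π (⊥ : Ideal R) (⊥ : Ideal Q)) (hQ : ConormalInequality (I.comap π)) :
    ConormalInequality I := by
  rcases eq_or_ne I ⊤ with rfl | hI
  · exact conormalInequality_top
  obtain ⟨hπ, xs, regx, -, hker, -⟩ := hdef
  let _ : Algebra Q R := π.toAlgebra
  obtain ⟨ys, regy, hdim, hle⟩ :=
    IsGorensteinLocalRing.exists_isRegular_of_isFiniteLength hI hfin
  have hartin := IsGorensteinLocalRing.isArtinGorensteinIdeal_ofList regy hdim
  obtain ⟨zs, rfl⟩ := List.map_surjective_iff.mpr hπ ys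
  have hcomap := ofList_append_eq_comap hπ hker zs
  have hlength : Module.length Q (Q ⧸ I.comap π) = Module.length R (R ⧸ I) :=
    length_quotient_comap hπ I
  rw [conormalInequality_iff hI regy hle hartin, List.length_map]
  have hle_add := ((conormalInequality_iff (by rwa [Ne, Ideal.comap_eq_top_iff])
    (isRegular_append_of_surjective hπ regx hker regy) (hcomap ▸ Ideal.comap_mono hle)
    (hcomap ▸ hartin.comap hπ)).mp hQ).trans (length_linearMap_comap_le hπ hker I)
  rw [hlength, List.length_append, Nat.cast_add, add_mul, add_comm] at hle_add
  exact (ENat.add_le_add_iff_right (WithTop.mul_ne_top (ENat.natCast_ne_top _)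
    (Module.length_ne_top_iff.mpr hfin))).mp hle_add

end Deformation

section Powers

open scoped Pointwise

variable {R : Type u} [CommRing R] (x : R) (j : ℕ) (N : Type v) [AddCommGroup N] [Module R N]

theorem pow_succ_smul_top_le : x ^ (j + 1) • (⊤ : Submodule R N) ≤ x • ⊤ := by
  rintro _ ⟨n, -, rfl⟩
  refine ⟨x ^ j • n, trivial, ?_⟩
  change x • x ^ j • n = x ^ (j + 1) • n
  rw [smul_smul, pow_succ']

/-- The map `N / xʲN → N / xʲ⁺¹N` induced by multiplication by `x`. -/
def quotPowMul : QuotSMulTop (x ^ j) N →ₗ[R] QuotSMulTop (x ^ (j + 1)) N :=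
  Submodule.mapQ _ _ (LinearMap.lsmul R N x) (by
    rintro _ ⟨n, -, rfl⟩
    refine ⟨n, trivial, ?_⟩
    change x ^ (j + 1) • n = x • x ^ j • n
    rw [smul_smul, pow_succ'])

/-- The projection `N / xʲ⁺¹N → N / xN`. -/
def quotPowProj : QuotSMulTop (x ^ (j + 1)) N →ₗ[R] QuotSMulTop x N :=
  Submodule.factor (pow_succ_smul_top_le x j N)

theorem surjective_quotPowProj : Function.Surjective (quotPowProj x j N) :=
  Submodule.factor_surjective (pow_succ_smul_top_le x j N)

theorem exact_quotPow : Function.Exact (quotPowMul x j N) (quotPowProj x j N) := by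
  intro y
  obtain ⟨n, rfl⟩ := Submodule.mkQ_surjective _ y
  constructor
  · intro h
    obtain ⟨m, -, hm⟩ := (Submodule.Quotient.mk_eq_zero (x • (⊤ : Submodule R N))).mp h
    exact ⟨Submodule.Quotient.mk m, congrArg Submodule.Quotient.mk hm⟩
  · rintro ⟨z, hz⟩
    obtain ⟨m, rfl⟩ := Submodule.mkQ_surjective _ z
    rw [← hz]
    exact (Submodule.Quotient.mk_eq_zero (x • (⊤ : Submodule R N))).mpr ⟨m, trivial, rfl⟩

theorem subsingleton_quotSMulTop_pow_zero : Subsingleton (QuotSMulTop (x ^ 0) N) := by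
  rw [Submodule.Quotient.subsingleton_iff, pow_zero, one_smul]

variable {x N}

theorem injective_quotPowMul (hx : IsSMulRegular N x) :
    Function.Injective (quotPowMul x j N) := by
  rw [injective_iff_map_eq_zero]
  intro y hy
  obtain ⟨n, rfl⟩ := Submodule.mkQ_surjective _ y
  obtain ⟨m, -, hm⟩ := (Submodule.Quotient.mk_eq_zero (x ^ (j + 1) • (⊤ : Submodule R N))).mp hy
  refine (Submodule.Quotient.mk_eq_zero (x ^ j • (⊤ : Submodule R N))).mpr ⟨m, trivial, hx ?_⟩
  change x • x ^ j • m = x • n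
  rw [smul_smul, ← pow_succ']
  exact hm

variable (x N) in
theorem length_quotSMulTop_pow_le (k : ℕ) :
    Module.length R (QuotSMulTop (x ^ k) N) ≤ k * Module.length R (QuotSMulTop x N) := by
  induction k with
  | zero =>
    have := subsingleton_quotSMulTop_pow_zero x N
    rw [Module.length_eq_zero]
    exact bot_le
  | succ k ih =>
    refine (length_le_add_of_exact (exact_quotPow x k N)).trans ?_
    rw [Nat.cast_add, add_mul, Nat.cast_one, one_mul]
    exact add_le_add_left ih _

theorem length_quotient_ofList_pow_le (xs : List R) (k : ℕ) (N : Type v)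
    [AddCommGroup N] [Module R N] :
    Module.length R (N ⧸ (Ideal.ofList (xs.map (· ^ k)) • (⊤ : Submodule R N))) ≤
      (k ^ xs.length : ℕ) * Module.length R (N ⧸ (Ideal.ofList xs • (⊤ : Submodule R N))) := by
  induction xs generalizing N with
  | nil =>
    rw [List.map_nil, List.length_nil, pow_zero, Nat.cast_one, one_mul]
  | cons x xs ih =>
    rw [List.map_cons,
      (Submodule.quotOfListConsSMulTopEquivQuotSMulTopInner N (x ^ k) _).length_eq,
      (Submodule.quotOfListConsSMulTopEquivQuotSMulTopOuter N x xs).length_eq]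
    refine (ih _).trans ?_
    rw [← (Submodule.quotOfListConsSMulTopEquivQuotSMulTopInner N (x ^ k) xs).length_eq,
      (Submodule.quotOfListConsSMulTopEquivQuotSMulTopOuter N (x ^ k) xs).length_eq,
      List.length_cons, pow_succ, Nat.cast_mul, mul_assoc]
    gcongr
    exact length_quotSMulTop_pow_le x _ k

end Powers

section IteratedExtension

open scoped Pointwise

theorem exact_compRight {R : Type u} [CommRing R] (J : Type w) [AddCommGroup J] [Module R J]
    {A B C : Type*} [AddCommGroup A] [Module R A] [AddCommGroup B] [Module R B] [AddCommGroup C]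
    [Module R C] {f : A →ₗ[R] B} {g : B →ₗ[R] C} (hf : Function.Injective f)
    (hfg : Function.Exact f g) :
    Function.Exact (LinearMap.compRight R f (M := J)) (LinearMap.compRight R g (M := J)) := by
  refine fun φ => ⟨fun hφ => ?_, ?_⟩
  · let ψ : J →ₗ[R] LinearMap.range f :=
      φ.codRestrict _ fun j => (hfg (φ j)).mp (LinearMap.congr_fun hφ j)
    refine ⟨(LinearEquiv.ofInjective f hf).symm.toLinearMap ∘ₗ ψ, LinearMap.ext fun j => ?_⟩
    exact congrArg Subtype.val ((LinearEquiv.ofInjective f hf).apply_symm_apply (ψ j))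
  · rintro ⟨ψ, rfl⟩
    exact LinearMap.ext fun j => hfg.apply_apply_eq_zero (ψ j)

/-- `IsIteratedExtension R X c M`: the module `M` has a filtration with `c` factors, each of them
isomorphic to `X`. -/
inductive IsIteratedExtension (R : Type u) [CommRing R] (X : Type v) [AddCommGroup X] [Module R X] :
    ℕ → ∀ (M : Type v) [AddCommGroup M] [Module R M], Prop
  | of_subsingleton (M : Type v) [AddCommGroup M] [Module R M] [Subsingleton M] :
      IsIteratedExtension R X 0 M
  | of_equiv {M : Type v} [AddCommGroup M] [Module R M] (e : X ≃ₗ[R] M) :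
      IsIteratedExtension R X 1 M
  | of_exact {A B C : Type v} [AddCommGroup A] [Module R A] [AddCommGroup B] [Module R B]
      [AddCommGroup C] [Module R C] {f : A →ₗ[R] B} {g : B →ₗ[R] C} {a c : ℕ}
      (hf : Function.Injective f) (hg : Function.Surjective g) (hfg : Function.Exact f g)
      (hA : IsIteratedExtension R X a A) (hC : IsIteratedExtension R X c C) :
      IsIteratedExtension R X (a + c) B

namespace IsIteratedExtension

variable {R : Type u} [CommRing R] {X A B : Type v} [AddCommGroup X] [Module R X]
  [AddCommGroup A] [Module R A] [AddCommGroup B] [Module R B]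

theorem congr {c : ℕ} (h : IsIteratedExtension R X c A) (e : A ≃ₗ[R] B) :
    IsIteratedExtension R X c B :=
  of_exact (g := (0 : B →ₗ[R] PUnit.{v + 1})) e.injective (Function.surjective_to_subsingleton _)
    (fun b => ⟨fun _ => e.surjective b, fun _ => rfl⟩) h (of_subsingleton PUnit)

theorem trans {a b : ℕ} (hB : IsIteratedExtension R A b B) (hA : IsIteratedExtension R X a A) :
    IsIteratedExtension R X (b * a) B := by
  induction hB with
  | of_subsingleton =>
    rw [zero_mul]
    exact of_subsingleton _
  | of_equiv e =>
    rw [one_mul]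
    exact hA.congr e
  | of_exact hf hg hfg _ _ ihA ihC =>
    rw [add_mul]
    exact of_exact hf hg hfg ihA ihC

theorem length_eq {c : ℕ} (h : IsIteratedExtension R X c A) :
    Module.length R A = c * Module.length R X := by
  induction h with
  | of_subsingleton => rw [Module.length_eq_zero, Nat.cast_zero, zero_mul]
  | of_equiv e => rw [e.length_eq, Nat.cast_one, one_mul]
  | of_exact hf hg hfg _ _ ihA ihC =>
    rw [Module.length_eq_add_of_exact _ _ hf hg hfg, ihA, ihC, Nat.cast_add, add_mul]

theorem length_linearMap_le (J : Type w) [AddCommGroup J] [Module R J] {c : ℕ}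
    (h : IsIteratedExtension R X c A) :
    Module.length R (J →ₗ[R] A) ≤ c * Module.length R (J →ₗ[R] X) := by
  induction h with
  | of_subsingleton => rw [Module.length_eq_zero, Nat.cast_zero, zero_mul]
  | of_equiv e => rw [(LinearEquiv.congrRight e).length_eq, Nat.cast_one, one_mul]
  | of_exact hf hg hfg _ _ ihA ihC =>
    rw [Nat.cast_add, add_mul]
    exact (length_le_add_of_exact (exact_compRight J hf hfg)).trans (add_le_add ihA ihC)

theorem quotSMulTop_pow {x : R} (hx : IsSMulRegular A x) (k : ℕ) :
    IsIteratedExtension R (QuotSMulTop x A) k (QuotSMulTop (x ^ k) A) := by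
  induction k with
  | zero =>
    have := subsingleton_quotSMulTop_pow_zero x A
    exact of_subsingleton _
  | succ k ih =>
    exact of_exact (injective_quotPowMul k hx) (surjective_quotPowProj x k A) (exact_quotPow x k A)
      ih (of_equiv (LinearEquiv.refl R _))

end IsIteratedExtension

open IsLocalRing

variable {R : Type u} [CommRing R] [IsLocalRing R] [IsNoetherianRing R] {N : Type v}
  [AddCommGroup N] [Module R N] [Module.Finite R N]

theorem isWeaklyRegular_cons_iff_isSMulRegular_quotient {x : R} {xs : List R}
    (hmem : ∀ r ∈ x :: xs, r ∈ maximalIdeal R) :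
    IsWeaklyRegular N (x :: xs) ↔ IsWeaklyRegular N xs ∧
      IsSMulRegular (N ⧸ (Ideal.ofList xs • (⊤ : Submodule R N))) x := by
  have hperm : (x :: xs).Perm (xs ++ [x]) := (List.perm_append_singleton x xs).symm
  rw [← isWeaklyRegular_singleton_iff, ← isWeaklyRegular_append_iff]
  exact ⟨fun h => isWeaklyRegular_of_perm_of_subset_maximalIdeal h hperm hmem, fun h =>
    isWeaklyRegular_of_perm_of_subset_maximalIdeal h hperm.symm
      fun r hr => hmem r (hperm.mem_iff.mpr hr)⟩

theorem isIteratedExtension_quotient_ofList_pow {xs : List R}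
    (hmem : ∀ x ∈ xs, x ∈ maximalIdeal R) {k : ℕ} (hk : k ≠ 0) (reg : IsWeaklyRegular N xs) :
    IsIteratedExtension R (N ⧸ (Ideal.ofList xs • (⊤ : Submodule R N))) (k ^ xs.length)
      (N ⧸ (Ideal.ofList (xs.map (· ^ k)) • (⊤ : Submodule R N))) := by
  induction xs generalizing N with
  | nil => exact .of_equiv (LinearEquiv.refl R _)
  | cons x xs ih =>
    obtain ⟨reg_xs, hx⟩ := (isWeaklyRegular_cons_iff_isSMulRegular_quotient hmem).mp reg
    have hmem_xs : ∀ r ∈ xs, r ∈ maximalIdeal R := fun r hr => hmem r (List.mem_cons_of_mem _ hr)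
    have hmem_pow : ∀ r ∈ x ^ k :: xs, r ∈ maximalIdeal R := List.forall_mem_cons.mpr
      ⟨Ideal.pow_mem_of_mem _ (hmem x List.mem_cons_self) k (Nat.pos_of_ne_zero hk), hmem_xs⟩
    have reg_pow : IsWeaklyRegular N (x ^ k :: xs) :=
      (isWeaklyRegular_cons_iff_isSMulRegular_quotient hmem_pow).mpr ⟨reg_xs, hx.pow k⟩
    have hinner := ih (N := QuotSMulTop (x ^ k) N) hmem_xs
      ((isWeaklyRegular_cons_iff N (x ^ k) xs).mp reg_pow).2
    have houter : IsIteratedExtension R (N ⧸ (Ideal.ofList (x :: xs) • (⊤ : Submodule R N))) k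
        (QuotSMulTop (x ^ k) N ⧸
          (Ideal.ofList xs • (⊤ : Submodule R (QuotSMulTop (x ^ k) N)))) :=
      have hpow := (IsIteratedExtension.quotSMulTop_pow hx k).congr
        ((Submodule.quotOfListConsSMulTopEquivQuotSMulTopOuter N (x ^ k) xs).symm.trans
          (Submodule.quotOfListConsSMulTopEquivQuotSMulTopInner N (x ^ k) xs))
      by
        simpa only [mul_one] using hpow.trans
          (.of_equiv (Submodule.quotOfListConsSMulTopEquivQuotSMulTopOuter N x xs))
    rw [List.length_cons, pow_succ, List.map_cons]
    exact (hinner.trans houter).congr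
      (Submodule.quotOfListConsSMulTopEquivQuotSMulTopInner N (x ^ k) _).symm

end IteratedExtension

section Growth

open IsLocalRing
open scoped Pointwise

variable {R : Type u} [CommRing R]

theorem ofList_pow_le_ofList_map_pow (xs : List R) (k : ℕ) :
    Ideal.ofList xs ^ (xs.length * k + 1) ≤ Ideal.ofList (xs.map (· ^ k)) := by
  induction xs with
  | nil => simp
  | cons x xs ih =>
    rw [Ideal.ofList_cons, List.map_cons, Ideal.ofList_cons, List.length_cons,
      show (xs.length + 1) * k + 1 = k + (xs.length * k + 1) by ring]
    exact Ideal.sup_pow_add_le_pow_sup_pow.trans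
      (sup_le_sup (Ideal.span_singleton_pow x k).le ih)

theorem isFiniteLength_quotient_of_ringKrullDim_le_height [IsLocalRing R] [IsNoetherianRing R]
    {I : Ideal R} (h : ringKrullDim R ≤ I.height) : IsFiniteLength R (R ⧸ I) := by
  rw [isFiniteLength_quotient_iff_krullDimLE_zero,
    Ideal.krullDimLE_zero_quotient_iff_forall_minimalPrimes_isMaximal]
  intro p hp
  have := hp.1.1
  rw [← maximalIdeal_height_eq_ringKrullDim, WithBot.coe_le_coe] at h
  rw [eq_of_le_of_not_lt (le_maximalIdeal this.ne_top) fun hlt =>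
    ((Ideal.height_strict_mono_of_isPrime_of_isPrime hlt).trans_le
      (h.trans (Ideal.height_mono hp.1.2))).false]
  exact maximalIdeal.isMaximal R

theorem exists_ofList_le_isFiniteLength [IsLocalRing R] [IsNoetherianRing R] {𝔞 : Ideal R}
    (h𝔞 : 𝔞 ≠ ⊤) (hfin : IsFiniteLength R (R ⧸ 𝔞)) {m : ℕ} (hm : ringKrullDim R = m) :
    ∃ ys : List R, ys.length = m ∧ Ideal.ofList ys ≤ 𝔞 ∧
      IsFiniteLength R (R ⧸ Ideal.ofList ys) := by
  have hheight := height_eq_ringKrullDim_of_isFiniteLength h𝔞 hfin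
  obtain ⟨K, hK𝔞, hrank, hK⟩ := Ideal.exists_spanRank_eq_and_height_eq 𝔞 h𝔞
  have hfg : Submodule.FG K := IsNoetherian.noetherian K
  obtain ⟨s, hs, hspan⟩ := Submodule.FG.exists_span_finset_card_eq_spanFinrank hfg
  have hlist : Ideal.ofList s.toList = K := by
    rw [Ideal.ofList, ← hspan]
    exact congrArg _ (Set.ext fun _ => Finset.mem_toList)
  refine ⟨s.toList, ?_, hlist ▸ hK𝔞, ?_⟩
  · have hm' : 𝔞.height = m := by exact_mod_cast hheight.trans hm
    rw [hm', Submodule.fg_iff_spanRank_eq_spanFinrank.mpr hfg] at hrank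
    rw [Finset.length_toList, hs]
    exact_mod_cast hrank
  · rw [hlist]
    exact isFiniteLength_quotient_of_ringKrullDim_le_height (hK ▸ hheight.ge)

theorem exists_length_quotient_ofList_pow_le [IsLocalRing R] [IsNoetherianRing R] {xs : List R}
    (hxs : Ideal.ofList xs ≠ ⊤) (hfin : IsFiniteLength R (R ⧸ Ideal.ofList xs)) {m : ℕ}
    (hm : ringKrullDim R = m) :
    ∃ c : ℕ, ∀ k ≠ 0,
      Module.length R (R ⧸ Ideal.ofList (xs.map (· ^ k))) ≤ (c * k ^ m : ℕ) := by
  obtain ⟨ys, rfl, hle, hys⟩ := exists_ofList_le_isFiniteLength hxs hfin hm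
  obtain ⟨l, hl⟩ := ENat.ne_top_iff_exists.mp (Module.length_ne_top_iff.mpr hys)
  refine ⟨(xs.length + 1) ^ ys.length * l, fun k hk => ?_⟩
  have hpow : Ideal.ofList (ys.map (· ^ (xs.length * k + 1))) ≤
      Ideal.ofList (xs.map (· ^ k)) := by
    refine Ideal.span_le.mpr fun y hy => ?_
    obtain ⟨z, hz, rfl⟩ := List.mem_map.mp hy
    exact ofList_pow_le_ofList_map_pow xs k (Ideal.pow_mem_pow (hle (Ideal.subset_span hz)) _)
  have hlength := length_quotient_ofList_pow_le ys (xs.length * k + 1) R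
  rw [smul_eq_mul, Ideal.mul_top, smul_eq_mul, Ideal.mul_top, ← hl, ← Nat.cast_mul] at hlength
  refine ((Module.length_le_of_surjective _ (Submodule.factor_surjective hpow)).trans
    hlength).trans (Nat.cast_le.mpr ?_)
  have hbase : xs.length * k + 1 ≤ (xs.length + 1) * k := by
    rw [add_mul, one_mul]
    exact Nat.add_le_add_left (Nat.one_le_iff_ne_zero.mpr hk) _
  calc (xs.length * k + 1) ^ ys.length * l
      ≤ ((xs.length + 1) * k) ^ ys.length * l := by gcongr
    _ = (xs.length + 1) ^ ys.length * l * k ^ ys.length := by rw [mul_pow, mul_right_comm]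

section Cokernel

variable {M N X : Type*} [AddCommGroup M] [Module R M] [AddCommGroup N] [Module R N]
  [AddCommGroup X] [Module R X]

theorem length_ker_lsmul_eq (hX : Module.length R X ≠ ⊤) (s : R) :
    Module.length R (LinearMap.ker (LinearMap.lsmul R X s)) =
      Module.length R (QuotSMulTop s X) := by
  have hrange : LinearMap.range (LinearMap.lsmul R X s) = s • ⊤ := LinearMap.range_eq_map _
  have hne : Module.length R (LinearMap.range (LinearMap.lsmul R X s)) ≠ ⊤ :=
    ne_top_of_le_ne_top hX (Module.length_le_of_injective _ (Submodule.injective_subtype _))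
  let im := LinearMap.range (LinearMap.lsmul R X s)
  have hadd := length_ker_add_length_range (LinearMap.lsmul R X s)
  rw [length_eq_length_add_length_quotient im, add_comm] at hadd
  rw [(WithTop.add_left_inj hne).mp hadd, (Submodule.quotEquivOfEq _ _ hrange).length_eq]

theorem length_linearMap_le_of_smul_mem_range {h : M →ₗ[R] N} {s : R}
    (hs : ∀ v, s • v ∈ LinearMap.range h) :
    Module.length R (N →ₗ[R] X) ≤
      Module.length R (N →ₗ[R] LinearMap.ker (LinearMap.lsmul R X s)) +
        Module.length R (M →ₗ[R] X) := by
  refine (length_le_length_ker_add (LinearMap.lcomp R X h)).trans (add_le_add_left ?_ _)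
  let K := LinearMap.ker (LinearMap.lsmul R X s)
  have hle : LinearMap.ker (LinearMap.lcomp R X h) ≤
      LinearMap.range (LinearMap.compRight R K.subtype (M := N)) := fun φ hφ =>
    ⟨φ.codRestrict K fun v => by
      obtain ⟨m, hm⟩ := hs v
      rw [LinearMap.mem_ker, LinearMap.lsmul_apply, ← map_smul, ← hm]
      exact LinearMap.congr_fun hφ m, rfl⟩
  exact (Module.length_le_of_injective _ (Submodule.inclusion_injective hle)).trans
    (Module.length_le_of_surjective _ (LinearMap.surjective_rangeRestrict _))

theorem mul_length_le_of_smul_mem_range {J : Ideal R} {d : ℕ} {h : M →ₗ[R] (Fin d → R ⧸ J)}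
    {s : R} (hs : ∀ v, s • v ∈ LinearMap.range h) (hX : Module.length R X ≠ ⊤)
    (hJ : J ≤ Module.annihilator R X) :
    d * Module.length R X ≤
      d * Module.length R (QuotSMulTop s X) + Module.length R (M →ₗ[R] X) := by
  have hJ' : J ≤ Module.annihilator R (LinearMap.ker (LinearMap.lsmul R X s)) :=
    hJ.trans (LinearMap.annihilator_le_of_injective _ (Submodule.injective_subtype _))
  have hle := length_linearMap_le_of_smul_mem_range (X := X) hs
  rwa [length_linearMap_pi_quotient d hJ, length_linearMap_pi_quotient d hJ',
    length_ker_lsmul_eq hX] at hle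

end Cokernel

end Growth

section GenericSurjection

open IsLocalRing

theorem exists_ringKrullDim_eq_natCast (R : Type u) [CommRing R] [FiniteRingKrullDim R] :
    ∃ d : ℕ, ringKrullDim R = d := by
  obtain ⟨e, he⟩ := WithBot.ne_bot_iff_exists.mp (ringKrullDim_ne_bot (R := R))
  obtain ⟨d, rfl⟩ := ENat.ne_top_iff_exists.mp fun h : e = ⊤ =>
    ringKrullDim_ne_top (R := R) (by rw [← he, h]; rfl)
  exact ⟨d, he.symm⟩

variable {R : Type u} [CommRing R] [IsNoetherianRing R]

theorem length_le_length_of_ofList_le [IsLocalRing R] {xs ys : List R} (regx : IsRegular R xs)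
    (regy : IsRegular R ys) (h : Ideal.ofList xs ≤ Ideal.ofList ys) :
    xs.length ≤ ys.length := by
  have := nontrivial_quotient_ofList regx
  have := IsLocalRing.of_surjective' (Ideal.Quotient.mk (Ideal.ofList xs))
    Ideal.Quotient.mk_surjective
  obtain ⟨a, ha⟩ := exists_ringKrullDim_eq_natCast (R ⧸ Ideal.ofList xs)
  have hdim : ringKrullDim (R ⧸ Ideal.ofList xs) + xs.length ≤
      ringKrullDim (R ⧸ Ideal.ofList xs) + ys.length := by
    rw [ringKrullDim_add_length_eq_ringKrullDim_of_isRegular xs regx,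
      ← ringKrullDim_add_length_eq_ringKrullDim_of_isRegular ys regy]
    exact add_le_add_left (ringKrullDim_le_of_surjective (Ideal.Quotient.factor h)
      (Ideal.Quotient.factor_surjective h)) _
  rw [ha] at hdim
  have : a + xs.length ≤ a + ys.length := by exact_mod_cast hdim
  exact Nat.le_of_add_le_add_left this

theorem IsCompleteIntersectionIdeal.exists_surjective_linearMap [IsLocalRing R] {J : Ideal R}
    (h : IsCompleteIntersectionIdeal J) {xs : List R} (reg : IsRegular R xs)
    (hle : Ideal.ofList xs ≤ J) :
    ∃ φ : J →ₗ[R] (Fin xs.length → R ⧸ J), Function.Surjective φ := by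
  obtain ⟨ys, regy, rfl⟩ := h
  have hlength := length_le_length_of_ofList_le reg regy hle
  let f : (Fin ys.length → R) →ₗ[R] (Fin xs.length → R ⧸ Ideal.ofList ys) :=
    (Ideal.ofList ys).mkQ.compLeft _ ∘ₗ LinearMap.funLeft R R (Fin.castLE hlength)
  have hf : Function.Surjective f := (Submodule.mkQ_surjective _).comp_left.comp
    (LinearMap.funLeft_surjective_of_injective R R _ (Fin.castLE_injective hlength))
  have hann : Ideal.ofList ys ≤ Module.annihilator R (Fin xs.length → R ⧸ Ideal.ofList ys) := by
    intro r hr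
    refine Module.mem_annihilator.mpr fun v => funext fun i => ?_
    exact Module.mem_annihilator.mp (Ideal.annihilator_quotient.ge hr) (v i)
  obtain ⟨φ, hφ⟩ := exists_linearMap_ofList_comp_eq regy.toIsWeaklyRegular hann f
  exact ⟨φ, .of_comp (g := combinationOfList ys) (by rwa [← LinearMap.coe_comp, hφ])⟩

omit [IsNoetherianRing R] in
theorem exists_linearMap_smul_mem_range_of_surjective (S : Submonoid R) {M M' N N' : Type*}
    [AddCommGroup M] [Module R M] [Module.FinitePresentation R M] [AddCommGroup M'] [Module R M']
    [AddCommGroup N] [Module R N] [AddCommGroup N'] [Module R N'] (f : M →ₗ[R] M')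
    [IsLocalizedModule S f] (g : N →ₗ[R] N') [IsLocalizedModule S g] {ψ : M' →ₗ[R] N'}
    (hψ : Function.Surjective ψ) :
    ∃ h : M →ₗ[R] N, ∀ v, ∃ t ∈ S, t • v ∈ LinearMap.range h := by
  obtain ⟨h, s, hs⟩ := Module.FinitePresentation.exists_lift_of_isLocalizedModule S g (ψ ∘ₗ f)
  refine ⟨h, fun v => ?_⟩
  obtain ⟨y, hy⟩ := hψ (g v)
  obtain ⟨⟨m, t⟩, hm⟩ := IsLocalizedModule.surj S f y
  have hgm : g (h m) = g ((s * t) • v) := calc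
    g (h m) = s • ψ (f m) := LinearMap.congr_fun hs m
    _ = s • ψ (t • y) := by rw [hm]
    _ = g ((s * t) • v) := by
      rw [LinearMap.map_smul_of_tower, hy, LinearMap.map_smul_of_tower, mul_smul]
  obtain ⟨c, hc⟩ := IsLocalizedModule.exists_of_eq (S := S) hgm
  refine ⟨c * (s * t), (c * (s * t)).2, c • m, ?_⟩
  rw [LinearMap.map_smul_of_tower, hc, smul_smul]
  rfl

theorem exists_linearMap_smul_mem_range_of_map {J q : Ideal R} [q.IsPrime] (hJq : J ≤ q)
    {xs : List R} (reg : IsWeaklyRegular R xs) (hle : Ideal.ofList xs ≤ J)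
    (h : IsCompleteIntersectionIdeal (J.map (algebraMap R (Localization.AtPrime q)))) :
    ∃ h : J →ₗ[R] (Fin xs.length → R ⧸ J), ∀ v, ∃ t ∉ q, t • v ∈ LinearMap.range h := by
  let A := Localization.AtPrime q
  have regA : IsRegular A (xs.map (algebraMap R A)) :=
    reg.isRegular_of_isLocalization_of_mem A q fun r hr => hJq (hle (Ideal.subset_span hr))
  have hleA : Ideal.ofList (xs.map (algebraMap R A)) ≤ J.map (algebraMap R A) := by
    rw [← Ideal.map_ofList]
    exact Ideal.map_mono hle
  rw [← Ideal.localized'_eq_map A q.primeCompl J] at h hleA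
  have hsurj := h.exists_surjective_linearMap regA hleA
  rw [List.length_map] at hsurj
  obtain ⟨φ, hφ⟩ := hsurj
  let J' := J.toLocalized' A q.primeCompl (Algebra.linearMap R A)
  let g : (Fin xs.length → R ⧸ J) →ₗ[R] _ := LinearMap.pi fun i =>
    J.toLocalizedQuotient' A q.primeCompl (Algebra.linearMap R A) ∘ₗ LinearMap.proj i
  have := Module.finitePresentation_of_finite R J
  exact exists_linearMap_smul_mem_range_of_surjective q.primeCompl J' g
    (ψ := φ.restrictScalars R) hφ

end GenericSurjection

section Gluing

variable {R : Type u} [CommRing R] {M N : Type*} [AddCommGroup M] [Module R M] [AddCommGroup N]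
  [Module R N]

/-- Modulo `q`, the map `h'` is a unit multiple of `h` at `q`, so Nakayama's lemma applies to its
cokernel. -/
theorem not_annihilator_quotient_range_le [Module.Finite R N] {q : Ideal R} [q.IsPrime]
    {h h' : M →ₗ[R] N} (hh : ∀ v, ∃ t ∉ q, t • v ∈ LinearMap.range h) {e : R} (he : e ∉ q)
    (hcong : ∀ x, h' x - e • h x ∈ q • (⊤ : Submodule R N)) :
    ¬ Module.annihilator R (N ⧸ LinearMap.range h') ≤ q := by
  let C := N ⧸ LinearMap.range h'
  intro hle
  have hsupp : (⟨q, inferInstance⟩ : PrimeSpectrum R) ∈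
      Module.support R (C ⧸ (q • (⊤ : Submodule R C))) := by
    rw [Module.support_quotient, Module.support_eq_zeroLocus]
    exact ⟨hle, le_refl q⟩
  obtain ⟨c, hc⟩ := Module.mem_support_iff'.mp hsupp
  obtain ⟨c, rfl⟩ := Submodule.mkQ_surjective _ c
  obtain ⟨v, rfl⟩ := Submodule.mkQ_surjective _ c
  obtain ⟨t, ht, x, hx⟩ := hh v
  refine hc (e * t) (fun hmem => (Ideal.IsPrime.mem_or_mem inferInstance hmem).elim he ht) ?_
  rw [← map_smul, ← map_smul, Submodule.mkQ_apply, Submodule.Quotient.mk_eq_zero, mul_smul, ← hx]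
  have hzero : (LinearMap.range h').mkQ (h' x) = 0 :=
    (Submodule.Quotient.mk_eq_zero _).mpr (LinearMap.mem_range_self h' x)
  have hneg := Submodule.smul_top_le_comap_smul_top q (LinearMap.range h').mkQ (hcong x)
  rw [Submodule.mem_comap, map_sub, hzero, zero_sub] at hneg
  exact neg_mem_iff.mp hneg

theorem exists_notMem_forall_mem_of_isAntichain {T : Finset (Ideal R)}
    (hprime : ∀ q ∈ T, q.IsPrime) (hT : IsAntichain (· ≤ ·) (T : Set (Ideal R))) {q : Ideal R}
    (hq : q ∈ T) : ∃ e ∉ q, ∀ q' ∈ T, q' ≠ q → e ∈ q' := by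
  classical
  have := hprime q hq
  by_contra! hcon
  have hle : (T.erase q).inf id ≤ q := fun e he => by
    by_contra heq
    obtain ⟨q', hq', hne, hmem⟩ := hcon e heq
    exact hmem (Submodule.mem_finsetInf.mp he q' (Finset.mem_erase.mpr ⟨hne, hq'⟩))
  obtain ⟨q', hq', hle'⟩ := (Ideal.IsPrime.inf_le' inferInstance).mp hle
  obtain ⟨hne, hq'⟩ := Finset.mem_erase.mp hq'
  exact hT hq' hq hne hle'

theorem exists_linearMap_forall_not_annihilator_le [Module.Finite R N] {T : Finset (Ideal R)}
    (hprime : ∀ q ∈ T, q.IsPrime) (hT : IsAntichain (· ≤ ·) (T : Set (Ideal R)))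
    (hloc : ∀ q ∈ T, ∃ h : M →ₗ[R] N, ∀ v, ∃ t ∉ q, t • v ∈ LinearMap.range h) :
    ∃ h : M →ₗ[R] N, ∀ q ∈ T, ¬ Module.annihilator R (N ⧸ LinearMap.range h) ≤ q := by
  classical
  choose! η hη using hloc
  choose! e he_notMem he_mem using fun q (hq : q ∈ T) =>
    exists_notMem_forall_mem_of_isAntichain hprime hT hq
  refine ⟨∑ q ∈ T, e q • η q, fun q hq => ?_⟩
  have := hprime q hq
  refine not_annihilator_quotient_range_le (hη q hq) (he_notMem q hq) fun x => ?_
  rw [LinearMap.sum_apply, ← Finset.add_sum_erase _ _ hq, LinearMap.smul_apply,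
    add_sub_cancel_left]
  refine Submodule.sum_mem _ fun q' hq' => ?_
  obtain ⟨hne, hq'⟩ := Finset.mem_erase.mp hq'
  exact Submodule.smul_mem_smul (he_mem q' hq' q hq hne.symm) trivial

variable [IsNoetherianRing R]

theorem exists_isSMulRegular_mem_of_forall_maximal_not_le (P : Type*) [AddCommGroup P]
    [Module R P] [Module.Finite R P] {𝔞 : Ideal R}
    (h𝔞 : ∀ q, Maximal (· ∈ associatedPrimes R P) q → ¬ 𝔞 ≤ q) :
    ∃ s ∈ 𝔞, IsSMulRegular P s := by
  have hfin := associatedPrimes.finite R P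
  by_contra! hcon
  have hsub : (𝔞 : Set R) ⊆ ⋃ q ∈ associatedPrimes R P, (q : Set R) := by
    rw [biUnion_associatedPrimes_eq_compl_regular]
    exact hcon
  obtain ⟨p, hp, hle⟩ := (Ideal.subset_union_prime_finite hfin (f := id) ⊥ ⊥
    fun q hq _ _ => IsAssociatedPrime.isPrime hq).mp hsub
  obtain ⟨q, hpq, hq⟩ := hfin.exists_le_maximal hp
  exact h𝔞 q hq (hle.trans hpq)

theorem exists_linearMap_isSMulRegular_smul_mem_range [Module.Finite R N] {P : Type*}
    [AddCommGroup P] [Module R P] [Module.Finite R P]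
    (hloc : ∀ q ∈ associatedPrimes R P,
      ∃ h : M →ₗ[R] N, ∀ v, ∃ t ∉ q, t • v ∈ LinearMap.range h) :
    ∃ (h : M →ₗ[R] N) (s : R), IsSMulRegular P s ∧ ∀ v, s • v ∈ LinearMap.range h := by
  have hfin : {q | Maximal (· ∈ associatedPrimes R P) q}.Finite :=
    (associatedPrimes.finite R P).subset fun _ hq => hq.1
  obtain ⟨h, hh⟩ := exists_linearMap_forall_not_annihilator_le (T := hfin.toFinset)
    (fun q hq => (hfin.mem_toFinset.mp hq).1.isPrime)
    (by rw [hfin.coe_toFinset]; exact setOfPred_maximal_antichain _)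
    fun q hq => hloc q (hfin.mem_toFinset.mp hq).1
  obtain ⟨s, hs, hreg⟩ := exists_isSMulRegular_mem_of_forall_maximal_not_le P
    fun q hq => hh q (hfin.mem_toFinset.mpr hq)
  refine ⟨h, s, hreg, fun v => ?_⟩
  rw [← Submodule.Quotient.mk_eq_zero, Submodule.Quotient.mk_smul]
  exact Module.mem_annihilator.mp hs _

theorem IsGenericallyCompleteIntersection.exists_linearMap {J : Ideal R}
    (hJ : IsGenericallyCompleteIntersection J) {xs : List R} (reg : IsWeaklyRegular R xs)
    (hle : Ideal.ofList xs ≤ J) :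
    ∃ (h : J →ₗ[R] (Fin xs.length → R ⧸ J)) (s : R),
      IsSMulRegular (R ⧸ J) s ∧ ∀ v, s • v ∈ LinearMap.range h := by
  refine exists_linearMap_isSMulRegular_smul_mem_range fun q hq => ?_
  have := hq.isPrime
  have hJq : J ≤ q := by
    rw [← Ideal.annihilator_quotient (I := J), ← Submodule.annihilator_top]
    exact IsAssociatedPrime.annihilator_le hq
  exact exists_linearMap_smul_mem_range_of_map hJq reg hle (hJ q hq)

end Gluing

section Asymptotics

open IsLocalRing nonZeroDivisors
open scoped Pointwise

/-- The error term grows more slowly than `kⁿ`, so it disappears in the limit. -/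
theorem mul_le_of_forall_mul_pow_le {d n c : ℕ} {L H : ℕ∞} {E : ℕ → ℕ∞} (hL : L ≠ ⊤)
    (hE : ∀ k ≠ 0, k * E k ≤ (c * k ^ n : ℕ))
    (h : ∀ k ≠ 0, d * ((k ^ n : ℕ) * L) ≤ d * E k + (k ^ n : ℕ) * H) : d * L ≤ H := by
  rcases eq_or_ne H ⊤ with rfl | hH
  · exact le_top
  lift L to ℕ using hL
  lift H to ℕ using hH
  obtain ⟨k, hk⟩ : ∃ k, k = d * c + 1 := ⟨_, rfl⟩
  have hk0 : k ≠ 0 := hk ▸ Nat.succ_ne_zero _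
  have hscaled : ((k ^ n * (k * (d * L)) : ℕ) : ℕ∞) ≤ (k ^ n * (d * c + k * H) : ℕ) := calc
    ((k ^ n * (k * (d * L)) : ℕ) : ℕ∞) = k * (d * ((k ^ n : ℕ) * L)) := by push_cast; ring
    _ ≤ k * (d * E k + (k ^ n : ℕ) * H) := by gcongr; exact h k hk0
    _ = d * (k * E k) + (k ^ n * (k * H) : ℕ) := by push_cast; ring
    _ ≤ d * (c * k ^ n : ℕ) + (k ^ n * (k * H) : ℕ) := by gcongr; exact hE k hk0
    _ = (k ^ n * (d * c + k * H) : ℕ) := by push_cast; ring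
  have hdiv : k * (d * L) ≤ d * c + k * H :=
    Nat.le_of_mul_le_mul_left (Nat.cast_le.mp hscaled) (Nat.pow_pos (Nat.pos_of_ne_zero hk0))
  suffices d * L ≤ H by exact_mod_cast this
  by_contra! hlt
  have hmul : k * (H + 1) ≤ k * (d * L) := Nat.mul_le_mul_left _ hlt
  rw [mul_add, mul_one] at hmul
  omega

theorem length_quotient_ofList_cons {R : Type u} [CommRing R] (s : R) (xs : List R) :
    Module.length R (R ⧸ Ideal.ofList (s :: xs)) =
      Module.length (R ⧸ Ideal.span {s}) ((R ⧸ Ideal.span {s}) ⧸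
        Ideal.ofList (xs.map (algebraMap R (R ⧸ Ideal.span {s})))) := by
  have hker : RingHom.ker (algebraMap R (R ⧸ Ideal.span {s})) = Ideal.ofList [s] :=
    (Ideal.mk_ker).trans (Ideal.ofList_singleton s).symm
  have hπ : Function.Surjective (algebraMap R (R ⧸ Ideal.span {s})) := Ideal.Quotient.mk_surjective
  rw [← length_quotient_comap hπ, ← ofList_append_eq_comap hπ hker, List.singleton_append]

/-- Modulo `s` the dimension drops, so the length grows like a polynomial of smaller degree. -/
theorem exists_mul_length_quotient_ofList_cons_pow_le {R : Type u} [CommRing R] [IsLocalRing R]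
    [IsNoetherianRing R] {xs : List R} (reg : IsRegular R xs)
    (hfin : IsFiniteLength R (R ⧸ Ideal.ofList xs)) {s : R} (hs : s ∈ R⁰) :
    ∃ c : ℕ, ∀ k : ℕ, k ≠ 0 →
      k * Module.length R (R ⧸ Ideal.ofList (s :: xs.map (· ^ k))) ≤ (c * k ^ xs.length : ℕ) := by
  let T := R ⧸ Ideal.span {s}
  by_cases hunit : IsUnit s
  · have : Subsingleton T := Ideal.Quotient.subsingleton_iff.mpr
      (Ideal.span_singleton_eq_top.mpr hunit)
    refine ⟨0, fun k _ => ?_⟩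
    rw [length_quotient_ofList_cons, Module.length_eq_zero, mul_zero]
    exact bot_le
  have : Nontrivial T := Ideal.Quotient.nontrivial_iff.mpr
    (mt Ideal.span_singleton_eq_top.mp hunit)
  have : IsLocalRing T := IsLocalRing.of_surjective' _ Ideal.Quotient.mk_surjective
  have hlocal : IsLocalHom (algebraMap R T) :=
    IsLocalHom.of_surjective _ Ideal.Quotient.mk_surjective
  obtain ⟨m, hm⟩ := exists_ringKrullDim_eq_natCast T
  have hlt : m + 1 ≤ xs.length := by
    have hdim := ringKrullDim_quotient_succ_le_of_nonZeroDivisor hs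
    rw [(isFiniteLength_quotient_ofList_iff reg).mp hfin, hm] at hdim
    exact_mod_cast hdim
  have hfinT : IsFiniteLength T (T ⧸ Ideal.ofList (xs.map (algebraMap R T))) := by
    rw [← Module.length_ne_top_iff, ← length_quotient_ofList_cons, Module.length_ne_top_iff]
    exact hfin.of_surjective (Submodule.factor_surjective (Ideal.ofList_cons s xs ▸ le_sup_right))
  have hne : Ideal.ofList (xs.map (algebraMap R T)) ≠ ⊤ := by
    rw [← Ideal.map_ofList]
    exact ne_top_of_le_ne_top (maximalIdeal.isMaximal T).ne_top ((Ideal.map_mono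
      (le_maximalIdeal (ofList_ne_top_of_isRegular reg))).trans
        (((local_hom_TFAE (algebraMap R T)).out 0 2).mp hlocal))
  obtain ⟨c, hc⟩ := exists_length_quotient_ofList_pow_le hne hfinT hm
  refine ⟨c, fun k hk => ?_⟩
  have hmap : (xs.map (· ^ k)).map (algebraMap R T) = (xs.map (algebraMap R T)).map (· ^ k) := by
    simp only [List.map_map, Function.comp_def, map_pow]
  rw [length_quotient_ofList_cons, hmap]
  calc (k : ℕ∞) * _ ≤ k * (c * k ^ m : ℕ) := by gcongr; exact hc k hk
    _ = (c * k ^ (m + 1) : ℕ) := by push_cast; ring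
    _ ≤ (c * k ^ xs.length : ℕ) := Nat.cast_le.mpr
      (Nat.mul_le_mul_left _ (Nat.pow_le_pow_right (Nat.pos_of_ne_zero hk) hlt))

theorem length_quotient_ofList_smul_top {R : Type u} {Q : Type v} [CommRing R] [CommRing Q]
    [Algebra Q R] (hπ : Function.Surjective (algebraMap Q R)) (xs : List Q) :
    Module.length Q (R ⧸ (Ideal.ofList xs • (⊤ : Submodule Q R))) =
      Module.length R (R ⧸ Ideal.ofList (xs.map (algebraMap Q R))) := by
  have htop := Ideal.smul_top_eq_map (S := R) (Ideal.ofList xs)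
  rw [Ideal.map_ofList] at htop
  rw [← Module.length_eq_of_surjective hπ, ((Submodule.quotEquivOfEq _ _ htop).trans
    (Submodule.Quotient.restrictScalarsEquiv Q _)).length_eq]

variable {Q : Type u} [CommRing Q] [IsLocalRing Q] [IsNoetherianRing Q] {J : Ideal Q}
  {xs : List Q}

theorem exists_mul_length_quotSMulTop_le (reg : IsRegular (Q ⧸ J) xs)
    (hfin : IsFiniteLength Q ((Q ⧸ J) ⧸ (Ideal.ofList xs • (⊤ : Submodule Q (Q ⧸ J))))) {s : Q}
    (hs : IsSMulRegular (Q ⧸ J) s) :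
    ∃ c : ℕ, ∀ k : ℕ, k ≠ 0 → k * Module.length Q (QuotSMulTop s
      ((Q ⧸ J) ⧸ (Ideal.ofList (xs.map (· ^ k)) • (⊤ : Submodule Q (Q ⧸ J))))) ≤
        (c * k ^ xs.length : ℕ) := by
  let B := Q ⧸ J
  have hπ : Function.Surjective (algebraMap Q B) := Ideal.Quotient.mk_surjective
  have : Nontrivial B := reg.nontrivial
  have : IsLocalRing B := IsLocalRing.of_surjective' _ hπ
  have regB : IsRegular B (xs.map (algebraMap Q B)) := by
    refine ⟨(isWeaklyRegular_map_algebraMap_iff B B xs).mpr reg.toIsWeaklyRegular,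
      fun h => reg.2 ?_⟩
    rw [Ideal.smul_top_eq_map, Ideal.map_ofList, ← Submodule.restrictScalars_top Q B B, h,
      smul_eq_mul, Ideal.mul_top]
  have hfinB : IsFiniteLength B (B ⧸ Ideal.ofList (xs.map (algebraMap Q B))) := by
    rw [← Module.length_ne_top_iff, ← length_quotient_ofList_smul_top hπ]
    exact Module.length_ne_top_iff.mpr hfin
  have hsB : algebraMap Q B s ∈ B⁰ := by
    refine mem_nonZeroDivisors_iff_right.mpr fun x hx => hs.right_eq_zero_of_smul ?_
    rw [Algebra.smul_def, mul_comm]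
    exact hx
  obtain ⟨c, hc⟩ := exists_mul_length_quotient_ofList_cons_pow_le regB hfinB hsB
  refine ⟨c, fun k hk => ?_⟩
  have hmap : (s :: xs.map (· ^ k)).map (algebraMap Q B) =
      algebraMap Q B s :: (xs.map (algebraMap Q B)).map (· ^ k) := by
    simp only [List.map_cons, List.map_map, Function.comp_def, map_pow]
  rw [← (Submodule.quotOfListConsSMulTopEquivQuotSMulTopOuter B s _).length_eq,
    length_quotient_ofList_smul_top hπ, hmap]
  simpa only [List.length_map] using hc k hk

theorem mul_length_quotient_ofList_le_of_smul_mem_range (hxs : ∀ x ∈ xs, x ∈ maximalIdeal Q)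
    (reg : IsRegular (Q ⧸ J) xs)
    (hfin : IsFiniteLength Q ((Q ⧸ J) ⧸ (Ideal.ofList xs • (⊤ : Submodule Q (Q ⧸ J)))))
    {M : Type*} [AddCommGroup M] [Module Q M] {d : ℕ} {f : M →ₗ[Q] (Fin d → Q ⧸ J)} {s : Q}
    (hs : IsSMulRegular (Q ⧸ J) s) (hrange : ∀ v, s • v ∈ LinearMap.range f) :
    d * Module.length Q ((Q ⧸ J) ⧸ (Ideal.ofList xs • (⊤ : Submodule Q (Q ⧸ J)))) ≤
      Module.length Q
        (M →ₗ[Q] ((Q ⧸ J) ⧸ (Ideal.ofList xs • (⊤ : Submodule Q (Q ⧸ J))))) := by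
  have hne := Module.length_ne_top_iff.mpr hfin
  obtain ⟨c, hc⟩ := exists_mul_length_quotSMulTop_le reg hfin hs
  refine mul_le_of_forall_mul_pow_le hne hc fun k hk => ?_
  have hext := isIteratedExtension_quotient_ofList_pow hxs hk reg.toIsWeaklyRegular
  have hJ : J ≤ Module.annihilator Q
      ((Q ⧸ J) ⧸ (Ideal.ofList (xs.map (· ^ k)) • (⊤ : Submodule Q (Q ⧸ J)))) :=
    Ideal.annihilator_quotient.ge.trans
      (LinearMap.annihilator_le_of_surjective _ (Submodule.mkQ_surjective _))
  rw [← hext.length_eq]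
  refine (mul_length_le_of_smul_mem_range hrange ?_ hJ).trans
    (add_le_add_right (hext.length_linearMap_le M) _)
  rw [hext.length_eq]
  exact WithTop.mul_ne_top (ENat.natCast_ne_top _) hne

end Asymptotics

section Smoothable

open IsLocalRing

theorem mem_ofList_smul_top_of_isWeaklyRegular {Q : Type u} [CommRing Q] {J : Ideal Q}
    {xs : List Q} (reg : IsWeaklyRegular (Q ⧸ J) xs) {j : J} (hj : (j : Q) ∈ Ideal.ofList xs) :
    j ∈ Ideal.ofList xs • (⊤ : Submodule Q J) := by
  have hexact := map_first_exact_on_four_term_right_exact_of_isSMulRegular_last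
    (LinearMap.exact_zero_iff_injective PUnit.{u + 1} J.subtype |>.mpr J.injective_subtype)
    (LinearMap.exact_subtype_mkQ J) (Submodule.mkQ_surjective J) reg
  obtain ⟨y, hy⟩ := (hexact (Submodule.Quotient.mk j)).mp (by
    refine (Submodule.Quotient.mk_eq_zero _).mpr ?_
    rwa [smul_eq_mul, Ideal.mul_top])
  obtain ⟨y, rfl⟩ := Submodule.mkQ_surjective _ y
  exact (Submodule.Quotient.mk_eq_zero _).mp hy.symm

section

variable {R : Type u} {Q : Type v} [CommRing R] [CommRing Q] [Algebra Q R]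
  (hπ : Function.Surjective (algebraMap Q R)) {J : Ideal Q} {xs : List Q}
  (hker : RingHom.ker (algebraMap Q R) = Ideal.ofList xs)

include hπ hker

theorem nonempty_quotient_smul_top_equiv_quotient_map (J : Ideal Q) :
    Nonempty (((Q ⧸ J) ⧸ (Ideal.ofList xs • (⊤ : Submodule Q (Q ⧸ J)))) ≃ₗ[Q]
      (R ⧸ J.map (algebraMap Q R))) := by
  have hcomap : J ⊔ Ideal.ofList xs = (J.map (algebraMap Q R)).comap (algebraMap Q R) := by
    rw [Ideal.comap_map_of_surjective _ hπ, ← RingHom.ker_eq_comap_bot, hker]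
  obtain ⟨e⟩ := nonempty_quotient_comap_equiv hπ (J.map (algebraMap Q R))
  exact ⟨(Submodule.quotEquivOfEq _ _ (Ideal.smul_top_eq_map _)).trans <|
    (Submodule.Quotient.restrictScalarsEquiv Q _).trans <|
      (DoubleQuot.quotQuotEquivQuotSupₐ Q J (Ideal.ofList xs)).toLinearEquiv.trans <|
        (Submodule.quotEquivOfEq _ _ hcomap).trans e⟩

theorem length_linearMap_le_length_linearMap_map (reg : IsWeaklyRegular (Q ⧸ J) xs)
    (N : Type*) [AddCommGroup N] [Module R N] [Module Q N] [IsScalarTower Q R N] :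
    Module.length Q (J →ₗ[Q] N) ≤ Module.length R (J.map (algebraMap Q R) →ₗ[R] N) := by
  rw [← Submodule.topEquiv.length_eq]
  refine length_submodule_linearMap_le hπ ⊤ fun φ _ j hj => ?_
  have hbot : Ideal.ofList xs • (⊤ : Submodule Q N) = ⊥ := by
    rw [eq_bot_iff, Submodule.smul_le]
    intro r hr n _
    have hr0 : algebraMap Q R r = 0 := hker.ge hr
    rw [Submodule.mem_bot, ← algebraMap_smul R r n, hr0, zero_smul]
  have hmem := Submodule.smul_top_le_comap_smul_top _ φ
    (mem_ofList_smul_top_of_isWeaklyRegular reg (hker.le hj))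
  rwa [hbot] at hmem

theorem exists_isWeaklyRegular_map_eq [IsLocalRing Q] [IsNoetherianRing Q] (regx : IsRegular Q xs)
    {ys : List R} (regy : IsRegular R ys) (hle : Ideal.ofList ys ≤ J.map (algebraMap Q R)) :
    ∃ zs : List Q, IsWeaklyRegular Q zs ∧ Ideal.ofList zs ≤ J ∧ zs.map (algebraMap Q R) = ys := by
  have hrange : ys ∈ Set.range (List.map fun j : J => algebraMap Q R j) := by
    rw [Set.range_list_map]
    intro y hy
    obtain ⟨j, hj, rfl⟩ :=
      (Ideal.mem_map_iff_of_surjective _ hπ).mp (hle (Ideal.subset_span hy))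
    exact ⟨⟨j, hj⟩, rfl⟩
  obtain ⟨js, rfl⟩ := hrange
  have hmap : (js.map Subtype.val).map (algebraMap Q R) =
      js.map fun j : J => algebraMap Q R j := List.map_map
  refine ⟨js.map Subtype.val, ?_, Ideal.span_le.mpr ?_, hmap⟩
  · have reg := isRegular_of_perm (isRegular_append_of_surjective hπ regx hker (hmap ▸ regy))
      List.perm_append_comm
    exact ((isWeaklyRegular_append_iff Q _ xs).mp reg.toIsWeaklyRegular).1
  · intro x hx
    obtain ⟨j, -, rfl⟩ := List.mem_map.mp hx
    exact j.2

end

theorem IsSmoothable.conormalInequality {R : Type u} [CommRing R] [IsGorensteinLocalRing R]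
    {I : Ideal R} (hfin : IsFiniteLength R (R ⧸ I)) (h : IsSmoothable.{u, v} I) :
    ConormalInequality I := by
  rcases eq_or_ne I ⊤ with rfl | hI
  · exact conormalInequality_top
  obtain ⟨Q, _, _, _, π, J, ⟨hπ, xs, regx, regJ, hker, rfl⟩, hgen⟩ := h
  obtain ⟨ys, regy, hdim, hle⟩ :=
    IsGorensteinLocalRing.exists_isRegular_of_isFiniteLength hI hfin
  rw [conormalInequality_iff hI regy hle
    (IsGorensteinLocalRing.isArtinGorensteinIdeal_ofList regy hdim)]
  let _ : Algebra Q R := π.toAlgebra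
  obtain ⟨zs, regz, hzJ, rfl⟩ := exists_isWeaklyRegular_map_eq hπ hker regx regy hle
  obtain ⟨f, s, hs, hrange⟩ := hgen.exists_linearMap regz hzJ
  obtain ⟨e⟩ := nonempty_quotient_smul_top_equiv_quotient_map hπ hker J
  have hlength := e.length_eq.trans (Module.length_eq_of_surjective hπ)
  have hfinQ := Module.length_ne_top_iff.mp (hlength.trans_ne (Module.length_ne_top_iff.mpr hfin))
  have hxs : ∀ x ∈ xs, x ∈ maximalIdeal Q := fun x hx =>
    le_maximalIdeal (ofList_ne_top_of_isRegular regx) (Ideal.subset_span hx)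
  have hmain := mul_length_quotient_ofList_le_of_smul_mem_range hxs regJ hfinQ hs hrange
  rw [hlength, ((LinearEquiv.refl Q J).arrowCongr e).length_eq] at hmain
  rw [List.length_map]
  exact hmain.trans
    (length_linearMap_le_length_linearMap_map hπ hker regJ.toIsWeaklyRegular (R ⧸ J.map π))

end Smoothable

theorem IsLicci.conormalInequality {R : Type u} [CommRing R] [IsGorensteinLocalRing R]
    {I : Ideal R} (h : IsLicci I) (hI : IsFiniteLength R (R ⧸ I)) : ConormalInequality I := by
  rcases eq_or_ne I ⊤ with rfl | hne
  · exact conormalInequality_top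
  obtain ⟨ys, regy, hdim, hle⟩ := IsGorensteinLocalRing.exists_isRegular_of_isFiniteLength hne hI
  rw [conormalInequality_iff hne regy hle
    (IsGorensteinLocalRing.isArtinGorensteinIdeal_ofList regy hdim)]
  exact (h.length_linearMap_eq hdim hI).ge

theorem proposition5p5 {R : Type u} [CommRing R] [IsGorensteinLocalRing R] (I : Ideal R)
    (hI : IsFiniteLength R (R ⧸ I)) :
    (∀ (Q : Type v) [CommRing Q] [IsLocalRing Q] [IsNoetherianRing Q] (π : Q →+* R),
        DeformsAlong π (⊥ : Ideal R) (⊥ : Ideal Q) → ConormalInequality (I.comap π) →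
          ConormalInequality I) ∧
      (IsSmoothable.{u, v} I → ConormalInequality I) ∧
      (IsLicci I → ConormalInequality I) :=
  ⟨fun _ _ _ _ _ hdef hQ => .of_deformsAlong hI hdef hQ,
    fun h => h.conormalInequality hI, fun h => h.conormalInequality hI⟩
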